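/- **Setting.** Let $f,g\in\mathbb{Q}[x,y]$ be such that $\Sigma=\{f=0,\ g=0\}$ is zero-dimensional, i.e. has finitely many solutions in $\mathbb{C}^2$. After multiplying $f$ and $g$ by the least common denominators of their coefficients we get $F,G\in\mathbb{Z}[x,y]$ with the same zeros. Put $\deg_x=\max(\deg_xF,\deg_xG)$, $\deg_y=\max(\deg_yF,\deg_yG)$ and $N=\max(\|F\|_1,\|G\|_1)$, where $\|\cdot\|_1$ is the sum of the absolute values of the coefficients. *Projections.* Let $t\in\mathbb{Z}[x]$ be $\mathrm{Res}_y(F,G)$ without extraneous factors: if $\mathrm{Res}_y(F,G)$ is irreducible over $\mathbb{Q}$, then $t=\mathrm{Res}_y(F,G)$; otherwise $t$ is the product of the distinct (sign-normalized) irreducible factors $p\in\mathbb{Z}[x]$ of $\mathrm{Res}_y(F,G)$ for which some complex solution $(x_0,y_0)$ of $\Sigma$ satisfies $p(x_0)=0$. Let $T\in\mathbb{Z}[y]$ be obtained in the same way from $\mathrm{Res}_x(F,G)$. Let $u$ and $v$ be the numbers of distinct real roots of $t$ and of $T$. *Threshold.* Put $M=\max(\|t\|_1,\|T\|_1)$,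 $s=\deg t\cdot\deg T$, let $c$ be any real number with $c\ge \deg_x/\deg t+\deg_y/\deg T$ (a quotient with denominator $0$ is read as $0$), and $\varepsilon=N^{1-s}M^{-cs}$. For real $\alpha,\beta$ let $|\Sigma|(\alpha,\beta)$ be $\max(|F(\alpha,\beta)|,|G(\alpha,\beta)|)$ if $F(\alpha,\beta)=0$ or $G(\alpha,\beta)=0$, and $\min(|F(\alpha,\beta)|,|G(\alpha,\beta)|)$ otherwise. *Algorithm ZMM.* (i) Compute $t$, $T$ and $\varepsilon$. (ii) Isolate the real roots of $P=t$ and of $P=T$ by subdivision with Descartes' rule of signs: nothing is done if $P$ is constant; otherwise start with the interval $(-B,B)$, $B=1+\max_i|a_i|$, where the $a_i$ are the coefficients of $P$; for an interval $(a,b)$ let $w$ be the number of sign variations in the coefficients of $(1+z)^{\deg P}P\big(\frac{a+bz}{1+z}\big)$; discard $(a,b)$ if $w=0$, report it if $w=1$, and if $w\ge2$ bisect it, reporting the midpoint if it is a root and continuing with the two open halves. One step is the treatment of one interval. (iii) For all pairs of reported intervals, representing the real roots $\alpha_i$ of $t$ and $\beta_j$ of $T$, test whether $|\Sigma|(\alpha_i,\beta_j)<\varepsilon$,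 and output the pairs that pass. One step is the test of one pair; the values at the exact real roots are used. **Theorem.** There is an absolute constant $K>0$ such that for all such $f,g$ and $c$ Algorithm ZMM terminates, and: 1. (Correctness) The intervals reported for $t$ and for $T$ isolate their real roots, the set of the output points $(\alpha_i,\beta_j)$ is exactly the set of real solutions of $\Sigma$, and the corresponding boxes (products of the reported intervals or points) isolate these solutions: each box contains exactly one real solution, and each real solution lies in exactly one box. 2. (Univariate solving) For $P=t$ and for $P=T$ the number of steps of the isolation is at most $K(d\tau+d\lg d)$, where $d=\deg P$, $\tau=1+\max_{a_i\ne0}\lg|a_i|$, $\lg=\log_2$, and $d\lg d=0$ for $d=0$. 3. (Matching) The number of steps of the matching is at most $K\,uv$. -/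

import Mathlib

open Polynomial
open scoped Polynomial.Bivariate

namespace ZMM

noncomputable section

/-! Bivariate polynomials are elements of `R[X][Y]`: the inner variable is `x`, the outer one `y`.
`aevalAeval x y f` is the value `f(x, y)`. -/

/-- The system `f = g = 0` has finitely many complex solutions. -/
def ZeroDimensional (f g : ℚ[X][Y]) : Prop :=
  {p : ℂ × ℂ | aevalAeval p.1 p.2 f = 0 ∧ aevalAeval p.1 p.2 g = 0}.Finite

/-- The set of real solutions of `f = g = 0`. -/
def realSolutions (f g : ℚ[X][Y]) : Set (ℝ × ℝ) :=
  {p : ℝ × ℝ | aevalAeval p.1 p.2 f = 0 ∧ aevalAeval p.1 p.2 g = 0}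

/-! ### Clearing denominators -/

/-- The least common multiple of the denominators of the coefficients of `f`. -/
def commonDen (f : ℚ[X][Y]) : ℕ :=
  f.support.lcm fun j => (f.coeff j).support.lcm fun i => ((f.coeff j).coeff i).den

/-- The integer polynomial `commonDen f • f`. -/
def clearDen (f : ℚ[X][Y]) : ℤ[X][Y] :=
  ∑ j ∈ f.support, monomial j
    (∑ i ∈ (f.coeff j).support, monomial i ((f.coeff j).coeff i * (commonDen f : ℚ)).num)

/-! ### Sizes of polynomials -/

/-- The one norm of a univariate integer polynomial. -/
def norm1 (P : ℤ[X]) : ℕ := ∑ i ∈ P.support, (P.coeff i).natAbs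

/-- The one norm of a bivariate integer polynomial. -/
def biNorm1 (F : ℤ[X][Y]) : ℕ := ∑ j ∈ F.support, norm1 (F.coeff j)

/-- The largest absolute value of a coefficient. -/
def height (P : ℤ[X]) : ℕ := P.support.sup fun i => (P.coeff i).natAbs

/-- `τ = 1 + max lg |a_i|`, the maximum being over the nonzero coefficients. -/
def bitsize (P : ℤ[X]) : ℝ := 1 + Real.logb 2 (height P)

/-- `d τ + d lg d`. -/
def solveBound (P : ℤ[X]) : ℝ :=
  P.natDegree * bitsize P + P.natDegree * Real.logb 2 P.natDegree

/-! ### Resultants without extraneous factors -/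

/-- A factor `p` of the resultant in `x` is extraneous when no complex solution of the system has
a root of `p` as its `x`-coordinate. -/
def Extraneous (F G : ℤ[X][Y]) (p : ℤ[X]) : Prop :=
  ¬ ∃ x y : ℂ, aevalAeval x y F = 0 ∧ aevalAeval x y G = 0 ∧ aeval x p = 0

open scoped Classical in
/-- The resultant with respect to `y`, returned unchanged when it is irreducible over `ℚ`.
Otherwise the extraneous irreducible factors (these include the constant ones) and the repetitions
of the other irreducible factors are discarded. -/
def noExtrRes (F G : ℤ[X][Y]) : ℤ[X] :=
  if Irreducible ((resultant F G).map (Int.castRingHom ℚ)) then resultant F G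
  else ∏ p ∈ (UniqueFactorizationMonoid.normalizedFactors (resultant F G)).toFinset.filter
    (fun p => ¬ Extraneous F G p), p

/-- The projection on the `x`-axis, `Res_y(F, G)` without extraneous factors. -/
def resX (F G : ℤ[X][Y]) : ℤ[X] := noExtrRes F G

/-- The projection on the `y`-axis, `Res_x(F, G)` without extraneous factors. -/
def resY (F G : ℤ[X][Y]) : ℤ[X] := noExtrRes (Bivariate.swap F) (Bivariate.swap G)

/-! ### The threshold -/

/-- The larger of the degrees of `F` and `G` in `x`. -/
def degX (F G : ℤ[X][Y]) : ℕ :=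
  max (Bivariate.swap F).natDegree (Bivariate.swap G).natDegree

/-- The larger of the degrees of `F` and `G` in `y`. -/
def degY (F G : ℤ[X][Y]) : ℕ := max F.natDegree G.natDegree

/-- `N`, the larger of the one norms of `F` and `G`. -/
def normN (F G : ℤ[X][Y]) : ℕ := max (biNorm1 F) (biNorm1 G)

/-- `M`, the larger of the one norms of the two projections. -/
def normM (F G : ℤ[X][Y]) : ℕ := max (norm1 (resX F G)) (norm1 (resY F G))

/-- `s`, the product of the degrees of the two projections. -/
def paramS (F G : ℤ[X][Y]) : ℕ := (resX F G).natDegree * (resY F G).natDegree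

/-- The condition on the constant `c` in the exponent of the threshold:
`deg_x / deg t + deg_y / deg T ≤ c`. -/
def Admissible (F G : ℤ[X][Y]) (c : ℝ) : Prop :=
  (degX F G : ℝ) / (resX F G).natDegree + (degY F G : ℝ) / (resY F G).natDegree ≤ c

/-- The threshold `ε = N ^ (1 - s) * M ^ (-c s)`. -/
def eps (F G : ℤ[X][Y]) (c : ℝ) : ℝ :=
  (normN F G : ℝ) ^ (1 - (paramS F G : ℤ)) * (normM F G : ℝ) ^ (-(c * paramS F G))

/-- The value `|Σ|` at `(a, b)`: the maximum of `|F(a, b)|` and `|G(a, b)|` if one of them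
vanishes, their minimum otherwise. -/
def sigmaAbs (F G : ℤ[X][Y]) (a b : ℝ) : ℝ :=
  if aevalAeval a b F = 0 ∨ aevalAeval a b G = 0 then
    max |aevalAeval a b F| |aevalAeval a b G|
  else min |aevalAeval a b F| |aevalAeval a b G|

/-! ### Real root isolation by subdivision and Descartes' rule of signs -/

/-- A pair `(a, b)` with `a < b` stands for the open interval, a pair `(a, a)` for the point. -/
def InIv (I : ℚ × ℚ) (x : ℝ) : Prop :=
  ((I.1 : ℝ) < x ∧ x < I.2) ∨ ((I.1 : ℝ) = x ∧ x = I.2)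

/-- `(1 + z) ^ d * P((a + b z) / (1 + z))` with `d = deg P`: its positive roots correspond to the
roots of `P` in the open interval `(a, b)`. -/
def moebius (P : ℤ[X]) (a b : ℚ) : ℚ[X] :=
  ∑ i ∈ Finset.range (P.natDegree + 1),
    C (P.coeff i : ℚ) * (C a + C b * X) ^ i * (1 + X) ^ (P.natDegree - i)

/-- The number of sign variations attached to `P` and the interval `(a, b)`. -/
def descartesVar (P : ℤ[X]) (a b : ℚ) : ℕ := (moebius P a b).signVariations

/-- `Subdivide P a b L n`: the subdivision procedure started on the open interval `(a, b)`
terminates with the list `L` of intervals after `n` steps. A step treats one interval: it is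
discarded (no sign variation), reported (one variation), or bisected (two or more); on bisection
the midpoint is reported if it is a root. -/
inductive Subdivide (P : ℤ[X]) : ℚ → ℚ → List (ℚ × ℚ) → ℕ → Prop
  | discard (a b : ℚ) (h : descartesVar P a b = 0) : Subdivide P a b [] 1
  | report (a b : ℚ) (h : descartesVar P a b = 1) : Subdivide P a b [(a, b)] 1
  | bisect (a b : ℚ) (L₁ L₂ : List (ℚ × ℚ)) (n₁ n₂ : ℕ) (h : 2 ≤ descartesVar P a b)
      (left : Subdivide P a ((a + b) / 2) L₁ n₁) (right : Subdivide P ((a + b) / 2) b L₂ n₂) :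
      Subdivide P a b
        (L₁ ++ (if aeval ((a + b) / 2) P = 0 then [((a + b) / 2, (a + b) / 2)] else []) ++ L₂)
        (n₁ + n₂ + 1)

/-- `Isolate P L n`: isolating the real roots of `P` gives the list `L` in `n` steps. Nothing is
done for a constant; otherwise the subdivision starts on `(-B, B)` with Cauchy's root bound
`B = 1 + max |a_i|`. -/
inductive Isolate (P : ℤ[X]) : List (ℚ × ℚ) → ℕ → Prop
  | const (h : P.natDegree = 0) : Isolate P [] 0
  | run (L : List (ℚ × ℚ)) (n : ℕ) (h : P.natDegree ≠ 0)
      (hrun : Subdivide P (-(1 + height P : ℚ)) (1 + height P : ℚ) L n) : Isolate P L n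

/-- `L` isolates the real roots of `P`: every listed interval contains exactly one real root, and
every real root lies in exactly one listed interval, listed once. -/
def IsIsolation (P : ℤ[X]) (L : List (ℚ × ℚ)) : Prop :=
  L.Nodup ∧ (∀ I ∈ L, ∃! x : ℝ, InIv I x ∧ aeval x P = 0) ∧
    ∀ x : ℝ, aeval x P = 0 → ∃! I, I ∈ L ∧ InIv I x

/-- The real root of `P` that is represented by an isolating interval `I`. -/
def isoRoot (P : ℤ[X]) (I : ℚ × ℚ) : ℝ :=
  Classical.epsilon fun x : ℝ => InIv I x ∧ aeval x P = 0

/-! ### Matching -/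

/-- The inner loop of the matching: the accepted pairs `(a, b)`, and the number of pairs tested. -/
def matchRow {A B : Type} (test : A → B → Bool) (a : A) : List B → List (A × B) × ℕ
  | [] => ([], 0)
  | b :: bs =>
      let r := matchRow test a bs
      (if test a b then (a, b) :: r.1 else r.1, r.2 + 1)

/-- The outer loop of the matching: the accepted pairs, and the number of pairs tested. -/
def matchAll {A B : Type} (test : A → B → Bool) : List A → List B → List (A × B) × ℕ
  | [], _ => ([], 0)
  | a :: as, bs =>
      let r := matchRow test a bs
      let q := matchAll test as bs
      (r.1 ++ q.1, r.2 + q.2)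

/-- The test `|Σ| < ε` at the real roots of the two projections represented by `I` and `J`. -/
def pairTest (F G : ℤ[X][Y]) (c : ℝ) (I J : ℚ × ℚ) : Bool :=
  decide (sigmaAbs F G (isoRoot (resX F G) I) (isoRoot (resY F G) J) < eps F G c)

/-! ### The algorithm -/

/-- The data produced by a run: isolating intervals of the real roots of the two projections with
the numbers of subdivision steps, and the matched pairs with the number of pairs tested. -/
structure Result where
  intervalsX : List (ℚ × ℚ)
  stepsX : ℕ
  intervalsY : List (ℚ × ℚ)
  stepsY : ℕ
  boxes : List ((ℚ × ℚ) × (ℚ × ℚ))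
  matchSteps : ℕ

/-- `RunInt F G c r`: the algorithm on integer polynomials terminates with result `r`. -/
def RunInt (F G : ℤ[X][Y]) (c : ℝ) (r : Result) : Prop :=
  Isolate (resX F G) r.intervalsX r.stepsX ∧
  Isolate (resY F G) r.intervalsY r.stepsY ∧
  (r.boxes, r.matchSteps) = matchAll (pairTest F G c) r.intervalsX r.intervalsY

/-- `Run f g c r`: the algorithm on rational polynomials terminates with result `r`. It first
clears the denominators. -/
def Run (f g : ℚ[X][Y]) (c : ℝ) (r : Result) : Prop :=
  RunInt (clearDen f) (clearDen g) c r

/-- The set of points represented by the matched pairs of intervals. -/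
def solutionSet (F G : ℤ[X][Y]) (r : Result) : Set (ℝ × ℝ) :=
  {p | ∃ B ∈ r.boxes, p = (isoRoot (resX F G) B.1, isoRoot (resY F G) B.2)}

/-- The boxes isolate the real solutions of `f = g = 0`: every listed box contains exactly one
real solution, and every real solution lies in exactly one listed box, listed once. -/
def IsolatesSolutions (f g : ℚ[X][Y]) (L : List ((ℚ × ℚ) × (ℚ × ℚ))) : Prop :=
  L.Nodup ∧
  (∀ B ∈ L, ∃! p : ℝ × ℝ, (InIv B.1 p.1 ∧ InIv B.2 p.2) ∧ p ∈ realSolutions f g) ∧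
  ∀ p ∈ realSolutions f g, ∃! B, B ∈ L ∧ InIv B.1 p.1 ∧ InIv B.2 p.2

end

end ZMM

/-! Isolation. Descartes' rule bounds the roots in an interval by the sign variations, and parity
turns one variation into an actual root, so a finished subdivision is correct. Finiteness and cost
rest on a weak two-circle theorem: if at most one complex root has distance less than `b - a` from
the midpoint of `(a, b)`, there is at most one variation (`signVariations_realMoebius_le_one`). Far
roots contribute linear and quadratic factors that preserve log-concavity of the Möbius transform,
and one further real linear factor produces at most one sign change. A bisected interval of width
`w` thus has two distinct roots near its midpoint, at mutual distance less than `2 w`. Charging it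
to one of them, a root `α` with separation bound `σ α` pays for at most two intervals per level, and
only while `σ α < 2 w`, so the cost is governed by the sum of `log (1 / σ α)`. This sum is
amortized: a close neighbour makes `P'(α)` small, whereas the product of the `P'(α)` over all roots,
times a power of the leading coefficient, is a nonzero integer. Landau's inequality then gives `d τ
+ d lg d` up to a constant (`exists_separation`). Separability of the projections is essential here;
it comes from Gauss's lemma (`separable_noExtrRes`).

Matching. Solutions project to roots of `t` and `T` because resultants lie in the ideal of `F` and
`G`. Conversely, two successive resultants show that the product of all `z - F(α_i, β_j)`, times
powers of leading coefficients, has integer coefficients. Its trailing coefficient is a nonzero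
integer, hence at least 1 in absolute value; bounding all factors but one from above bounds the
remaining nonzero value from below (`one_le_norm_aevalAeval_mul`). The bound is at least `ε`, so the
test detects common zeros exactly. -/

namespace Polynomial

/-! ### Sign variations and Descartes' rule for zero or one variation -/

theorem coeffList_map_of_injective {R S : Type*} [Semiring R] [Semiring S] {f : R →+* S}
    (hf : Function.Injective f) (p : R[X]) : (p.map f).coeffList = p.coeffList.map f := by
  simp [coeffList, degree_map_eq_of_injective hf, Function.comp_def]

theorem signVariations_map_ratCast (p : ℚ[X]) :
    (p.map (algebraMap ℚ ℝ)).signVariations = p.signVariations := by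
  have h : ∀ x : ℚ, SignType.sign ((algebraMap ℚ ℝ) x) = SignType.sign x := by
    intro x
    rcases lt_trichotomy x 0 with hx | rfl | hx
    · rw [sign_neg hx, sign_neg (by simpa using hx)]
    · simp
    · rw [sign_pos hx, sign_pos (by simpa using hx)]
  have h' : SignType.sign ∘ (algebraMap ℚ ℝ) = (SignType.sign : ℚ → SignType) := by
    ext x; exact h x
  rw [signVariations, signVariations, coeffList_map_of_injective (algebraMap ℚ ℝ).injective,
    List.map_map]
  rw [← h']

variable {P : ℝ[X]}

theorem signVariations_eq_zero_of_nonneg (h : ∀ i, 0 ≤ P.coeff i) : P.signVariations = 0 := by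
  induction hn : P.support.card using Nat.strong_induction_on generalizing P with | _ n ih =>
  by_cases hP : P = 0
  · simp [hP]
  have hE : ∀ i, 0 ≤ P.eraseLead.coeff i := fun i => by
    rw [eraseLead_coeff]; split_ifs <;> simp [h]
  rw [signVariations_eq_eraseLead_add_ite hP,
    ih _ (hn ▸ eraseLead_support_card_lt hP) hE rfl, if_neg, add_zero]
  have h1 : 0 < P.leadingCoeff := lt_of_le_of_ne (h _) (Ne.symm (leadingCoeff_ne_zero.mpr hP))
  rw [sign_pos h1]
  rcases (hE P.eraseLead.natDegree).eq_or_lt with h2 | h2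
  · rw [leadingCoeff, ← h2]; simp
  · rw [leadingCoeff, sign_pos h2]; decide

theorem signVariations_eq_zero_of_nonpos (h : ∀ i, P.coeff i ≤ 0) : P.signVariations = 0 := by
  rw [← signVariations_neg]
  exact signVariations_eq_zero_of_nonneg fun i => by simpa using h i

/-- At most one sign variation if the indices of nonnegative coefficients are closed upwards. -/
theorem signVariations_le_one_of_nonneg_of_le
    (h : ∀ i j, i ≤ j → 0 ≤ P.coeff i → 0 ≤ P.coeff j) : P.signVariations ≤ 1 := by
  -- A nonnegative coefficient at or below the degree would force the leading one to be nonnegative.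
  have key : ∀ Q : ℝ[X], (∀ i j, i ≤ j → 0 ≤ Q.coeff i → 0 ≤ Q.coeff j) → Q.leadingCoeff < 0 →
      Q.signVariations = 0 := by
    intro Q hQ hl
    refine signVariations_eq_zero_of_nonpos fun i => ?_
    rcases lt_or_ge Q.natDegree i with hi | hi
    · rw [coeff_eq_zero_of_natDegree_lt hi]
    · by_contra hc
      exact absurd (hQ i _ hi (not_le.mp hc).le) (not_le.mpr hl)
  induction hn : P.support.card using Nat.strong_induction_on generalizing P with | _ n ih =>
  by_cases hP : P = 0
  · simp [hP]
  rcases lt_or_gt_of_ne (leadingCoeff_ne_zero.mpr hP) with hl | hl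
  · simp [key P h hl]
  have hE : ∀ i j, i ≤ j → 0 ≤ P.eraseLead.coeff i → 0 ≤ P.eraseLead.coeff j := by
    intro i j hij hi
    rw [eraseLead_coeff] at hi ⊢
    split_ifs with hj
    · rfl
    · split_ifs at hi with hi'
      · exact h i j hij (by rw [hi']; exact hl.le)
      · exact h i j hij hi
  rw [signVariations_eq_eraseLead_add_ite hP]
  rcases lt_or_ge P.eraseLead.leadingCoeff 0 with h2 | h2
  · rw [key _ hE h2]; split_ifs <;> simp
  · have := ih _ (hn ▸ eraseLead_support_card_lt hP) hE rfl
    rw [if_neg]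
    · simpa using this
    · rw [sign_pos hl]
      rcases h2.eq_or_lt with h3 | h3
      · rw [← h3]; simp
      · rw [sign_pos h3]; decide

theorem trailingCoeff_eraseLead (h : P.eraseLead ≠ 0) :
    P.eraseLead.trailingCoeff = P.trailingCoeff := by
  have hP : P ≠ 0 := by rintro rfl; simp at h
  have hlt : P.natTrailingDegree < P.natDegree := by
    by_contra hc
    apply h
    ext i
    rw [eraseLead_coeff]
    split_ifs with hi
    · simp
    · rcases lt_or_gt_of_ne hi with hi | hi
      · simp [coeff_eq_zero_of_lt_natTrailingDegree (hi.trans_le (not_lt.mp hc))]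
      · simp [coeff_eq_zero_of_natDegree_lt hi]
  have hco : P.eraseLead.coeff P.natTrailingDegree = P.trailingCoeff := by
    rw [eraseLead_coeff, if_neg hlt.ne]; rfl
  have hd : P.eraseLead.natTrailingDegree = P.natTrailingDegree := by
    apply le_antisymm
    · exact natTrailingDegree_le_of_ne_zero (by
        rw [hco]; exact mt trailingCoeff_eq_zero.mp hP)
    · refine le_natTrailingDegree h fun m hm => ?_
      rw [eraseLead_coeff, coeff_eq_zero_of_lt_natTrailingDegree hm]; simp
  rw [trailingCoeff, hd, hco]

/-- Parity in Descartes' rule: between the trailing and the leading coefficient every variation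
flips the sign once. -/
theorem sign_leadingCoeff_eq_neg_one_pow_signVariations_mul (hP : P ≠ 0) :
    SignType.sign P.leadingCoeff = (-1) ^ P.signVariations * SignType.sign P.trailingCoeff := by
  induction hn : P.support.card using Nat.strong_induction_on generalizing P with | _ n ih =>
  rw [signVariations_eq_eraseLead_add_ite hP]
  by_cases hE : P.eraseLead = 0
  · have : P = monomial P.natDegree P.leadingCoeff := by
      conv_lhs => rw [← eraseLead_add_monomial_natDegree_leadingCoeff P, hE, zero_add]
    have h2 : P.trailingCoeff = P.leadingCoeff := by
      conv_lhs => rw [this]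
      rw [trailingCoeff, natTrailingDegree_monomial (leadingCoeff_ne_zero.mpr hP)]
      simp
    simp [hE, h2, hP]
  · have := ih _ (hn ▸ eraseLead_support_card_lt hP) hE rfl
    rw [trailingCoeff_eraseLead hE] at this
    have h1 : SignType.sign P.leadingCoeff ≠ 0 := by simpa using hP
    have h2 : SignType.sign P.eraseLead.leadingCoeff ≠ 0 := by simpa using hE
    split_ifs with hs
    · rw [hs, this, pow_succ]; simp
    · rw [add_zero, ← this]
      revert h1 h2 hs
      generalize SignType.sign P.leadingCoeff = x
      generalize SignType.sign P.eraseLead.leadingCoeff = y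
      revert x y; decide

/-- By parity the leading and trailing coefficients have opposite signs. After division by the power
of `X`, the value at 0 and the values near infinity differ in sign. -/
theorem exists_pos_root_of_signVariations_eq_one (h : P.signVariations = 1) :
    ∃ x, 0 < x ∧ P.eval x = 0 := by
  wlog hl : 0 < P.leadingCoeff generalizing P
  · have hP : P ≠ 0 := by rintro rfl; simp at h
    obtain ⟨x, hx, hx'⟩ := @this (-P) (by simpa using h) (by
      rw [leadingCoeff_neg]
      have := lt_of_le_of_ne (not_lt.mp hl) (leadingCoeff_ne_zero.mpr hP)
      linarith)
    exact ⟨x, hx, by simpa using hx'⟩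
  have hP : P ≠ 0 := by rintro rfl; simp at h
  have hs := sign_leadingCoeff_eq_neg_one_pow_signVariations_mul hP
  rw [h, sign_pos hl] at hs
  have ht : P.trailingCoeff < 0 := by
    rw [← sign_eq_neg_one_iff]
    revert hs
    generalize SignType.sign P.trailingCoeff = y
    revert y; decide
  obtain ⟨Q, hQ⟩ : X ^ P.natTrailingDegree ∣ P :=
    X_pow_dvd_iff.mpr fun d hd => coeff_eq_zero_of_lt_natTrailingDegree hd
  have hQ0 : Q.eval 0 < 0 := by
    have : P.trailingCoeff = Q.coeff 0 := by
      have := coeff_X_pow_mul Q P.natTrailingDegree 0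
      rwa [← hQ, zero_add] at this
    rwa [← coeff_zero_eq_eval_zero, ← this]
  have hQl : 0 < Q.leadingCoeff := by
    have : P.leadingCoeff = Q.leadingCoeff := by
      conv_lhs => rw [hQ]
      generalize P.natTrailingDegree = k
      simp
    rwa [← this]
  obtain ⟨y, hy, hy'⟩ : ∃ y, 0 < y ∧ 0 ≤ Q.eval y := by
    rcases Nat.eq_zero_or_pos Q.natDegree with hd | hd
    · rw [eq_C_of_natDegree_eq_zero hd] at hQ0 hQl
      simp at hQ0 hQl
      linarith
    · have := Q.tendsto_atTop_of_leadingCoeff_nonneg (natDegree_pos_iff_degree_pos.mp hd) hQl.le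
      obtain ⟨y, h1, h2⟩ := ((this.eventually_ge_atTop 0).and
        (Filter.eventually_gt_atTop 0)).exists
      exact ⟨y, h2, h1⟩
  obtain ⟨x, hx, hx'⟩ := intermediate_value_Icc hy.le (Q.continuous.continuousOn)
    (show (0 : ℝ) ∈ Set.Icc _ _ from ⟨hQ0.le, hy'⟩)
  have hxpos : 0 < x := lt_of_le_of_ne hx.1 (by rintro rfl; exact hQ0.ne hx')
  exact ⟨x, hxpos, by rw [hQ]; simp [hx']⟩

end Polynomial

/-! ### Möbius transforms of real polynomials -/

namespace ZMM

/-- `(1 + z) ^ n * p((a + b z) / (1 + z))` for a real polynomial `p` of degree at most `n`. -/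
noncomputable def realMoebius (n : ℕ) (p : ℝ[X]) (a b : ℝ) : ℝ[X] :=
  ∑ i ∈ Finset.range (n + 1), C (p.coeff i) * (C a + C b * X) ^ i * (1 + X) ^ (n - i)

theorem map_moebius (P : ℤ[X]) (a b : ℚ) :
    (moebius P a b).map (algebraMap ℚ ℝ) =
      realMoebius P.natDegree (P.map (algebraMap ℤ ℝ)) a b := by
  simp [moebius, realMoebius, Polynomial.map_sum]

theorem eval_realMoebius {n : ℕ} {p : ℝ[X]} (hp : p.natDegree ≤ n) (a b : ℝ) {z : ℝ}
    (hz : 1 + z ≠ 0) :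
    (realMoebius n p a b).eval z = (1 + z) ^ n * p.eval ((a + b * z) / (1 + z)) := by
  rw [eval_eq_sum_range' (Nat.lt_succ_of_le hp), realMoebius, eval_finsetSum, Finset.mul_sum]
  refine Finset.sum_congr rfl fun i hi => ?_
  have hi' : i ≤ n := Nat.lt_succ_iff.mp (Finset.mem_range.mp hi)
  obtain ⟨k, rfl⟩ := Nat.exists_eq_add_of_le hi'
  simp only [eval_mul, eval_C, eval_pow, eval_add, eval_X, eval_one, div_pow, pow_add,
    Nat.add_sub_cancel_left]
  field_simp

/-- Identities between Möbius transforms are checked at positive `z` only, where `1 + z` is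
invertible. -/
theorem eq_of_eval_eq_of_pos {p q : ℝ[X]} (h : ∀ z, 0 < z → p.eval z = q.eval z) : p = q :=
  eq_of_infinite_eval_eq p q ((Set.Ioi_infinite (0 : ℝ)).mono fun z hz => h z hz)

/-- The formal degree is a parameter so that the transform is multiplicative; this reduces it to
linear and quadratic real factors. -/
theorem realMoebius_mul {m n : ℕ} {p q : ℝ[X]} (hp : p.natDegree ≤ m) (hq : q.natDegree ≤ n)
    (a b : ℝ) :
    realMoebius (m + n) (p * q) a b = realMoebius m p a b * realMoebius n q a b := by
  refine eq_of_eval_eq_of_pos fun z hz => ?_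
  have hz' : 1 + z ≠ 0 := by positivity
  rw [eval_mul, eval_realMoebius hp _ _ hz', eval_realMoebius hq _ _ hz',
    eval_realMoebius (natDegree_mul_le.trans (add_le_add hp hq)) _ _ hz', eval_mul, pow_add]
  ring

theorem realMoebius_linear (r a b : ℝ) :
    realMoebius 1 (X - C r) a b = C (b - r) * X + C (a - r) := by
  refine eq_of_eval_eq_of_pos fun z hz => ?_
  have hz' : 1 + z ≠ 0 := by positivity
  rw [eval_realMoebius (natDegree_X_sub_C_le r) _ _ hz']
  simp
  field_simp
  ring

/-- For `u = 2 Re z` and `v = |z|²` the outer coefficients are `|b - z|²` and `|a - z|²`. -/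
theorem realMoebius_quadratic (u v a b : ℝ) :
    realMoebius 2 (X ^ 2 - C u * X + C v) a b =
      C (b ^ 2 - u * b + v) * X ^ 2 + C (2 * a * b - u * (a + b) + 2 * v) * X
        + C (a ^ 2 - u * a + v) := by
  refine eq_of_eval_eq_of_pos fun z hz => ?_
  have hz' : 1 + z ≠ 0 := by positivity
  rw [eval_realMoebius (by compute_degree) _ _ hz']
  simp
  field_simp
  ring

/-! ### Log-concave coefficients -/

/-- The coefficients are positive up to some index, vanish beyond it, and are log-concave. -/
structure LogConcave (p : ℝ[X]) : Prop where
  nonneg : ∀ i, 0 ≤ p.coeff i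
  pos : 0 < p.coeff 0
  zero_succ : ∀ i, p.coeff i = 0 → p.coeff (i + 1) = 0
  concave : ∀ i, p.coeff i * p.coeff (i + 2) ≤ p.coeff (i + 1) ^ 2

theorem LogConcave.one : LogConcave 1 where
  nonneg i := by rw [coeff_one]; split_ifs <;> simp
  pos := by simp
  zero_succ i _ := by simp [coeff_one]
  concave i := by simp [coeff_one]

/-- Ratios of successive coefficients decrease. The induction cancels `p.coeff (i + k + 1)`; if that
vanishes, so do all later coefficients. -/
theorem LogConcave.mul_le {p : ℝ[X]} (h : LogConcave p) (i k : ℕ) :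
    p.coeff i * p.coeff (i + k + 2) ≤ p.coeff (i + 1) * p.coeff (i + k + 1) := by
  induction k with
  | zero => simpa [sq] using h.concave i
  | succ k ih =>
    have e2 := h.concave (i + k + 1)
    have n0 := h.nonneg i
    have n1 := h.nonneg (i + 1)
    have n2 := h.nonneg (i + k + 2)
    have n3 := h.nonneg (i + k + 3)
    rw [show i + (k + 1) + 2 = i + k + 3 by ring, show i + (k + 1) + 1 = i + k + 2 by ring]
    rcases (h.nonneg (i + k + 1)).eq_or_lt with h0 | h0
    · have h1 := h.zero_succ _ h0.symm
      have h2 := h.zero_succ _ h1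
      rw [show i + k + 3 = i + k + 1 + 1 + 1 by ring, h2]
      simp only [mul_zero]; positivity
    · rw [show i + k + 1 + 2 = i + k + 3 by ring, show i + k + 1 + 1 = i + k + 2 by ring] at e2
      refine le_of_mul_le_mul_right ?_ h0
      calc _ = p.coeff i * (p.coeff (i + k + 1) * p.coeff (i + k + 3)) := by ring
        _ ≤ p.coeff i * p.coeff (i + k + 2) ^ 2 := by gcongr
        _ = p.coeff i * p.coeff (i + k + 2) * p.coeff (i + k + 2) := by ring
        _ ≤ p.coeff (i + 1) * p.coeff (i + k + 1) * p.coeff (i + k + 2) := by gcongr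
        _ = _ := by ring

/-- Cauchy–Binet: the difference of the two sides is a sum of six products of 2×2 minors, one from
the Toeplitz matrix of `(A, B, C)` and one from that of the sequence `e, x, y, z, w`. -/
theorem concave_combination {e x y z w A B C : ℝ} (hA : 0 ≤ A) (hB : 0 ≤ B) (hC : 0 ≤ C)
    (hABC : A * C ≤ B ^ 2) (h1 : e * y ≤ x ^ 2) (h2 : e * z ≤ x * y) (h3 : x * z ≤ y ^ 2)
    (h4 : e * w ≤ x * z) (h5 : x * w ≤ y * z) (h6 : y * w ≤ z ^ 2) :
    (A * e + B * x + C * y) * (A * y + B * z + C * w) ≤ (A * x + B * y + C * z) ^ 2 := by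
  have t1 := mul_nonneg (mul_nonneg hA hA) (sub_nonneg.mpr h1)
  have t2 := mul_nonneg (mul_nonneg hA hB) (sub_nonneg.mpr h2)
  have t3 := mul_nonneg (sub_nonneg.mpr hABC) (sub_nonneg.mpr h3)
  have t4 := mul_nonneg (mul_nonneg hA hC) (sub_nonneg.mpr h4)
  have t5 := mul_nonneg (mul_nonneg hB hC) (sub_nonneg.mpr h5)
  have t6 := mul_nonneg (mul_nonneg hC hC) (sub_nonneg.mpr h6)
  linear_combination t1 + t2 + t3 + t4 + t5 + t6

theorem coeff_quadratic_mul_zero (A B C' : ℝ) (p : ℝ[X]) :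
    ((C A * X ^ 2 + C B * X + C C') * p).coeff 0 = C' * p.coeff 0 := by
  simp [mul_coeff_zero]

theorem coeff_quadratic_mul_one (A B C' : ℝ) (p : ℝ[X]) :
    ((C A * X ^ 2 + C B * X + C C') * p).coeff 1 = B * p.coeff 0 + C' * p.coeff 1 := by
  have : (C A * X ^ 2 + C B * X + C C') * p = C A * (X * (X * p)) + C B * (X * p) + C C' * p := by
    ring
  simp only [this, coeff_add, coeff_C_mul, coeff_X_mul, mul_coeff_zero, coeff_X_zero]
  simp

theorem coeff_quadratic_mul_add_two (A B C' : ℝ) (p : ℝ[X]) (k : ℕ) :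
    ((C A * X ^ 2 + C B * X + C C') * p).coeff (k + 2) =
      A * p.coeff k + B * p.coeff (k + 1) + C' * p.coeff (k + 2) := by
  have : (C A * X ^ 2 + C B * X + C C') * p = C A * (X * (X * p)) + C B * (X * p) + C C' * p := by
    ring
  simp only [this, coeff_add, coeff_C_mul, coeff_X_mul]

/-- Log-concavity survives convolution with a log-concave triple. Since `A = 0` is allowed, linear
factors are covered too; `B > 0` rules out internal zeros. -/
theorem LogConcave.quadratic_mul {p : ℝ[X]} (h : LogConcave p) {A B C' : ℝ} (hA : 0 ≤ A)
    (hB : 0 < B) (hC : 0 < C') (hABC : A * C' ≤ B ^ 2) :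
    LogConcave ((C A * X ^ 2 + C B * X + C C') * p) := by
  have n := h.nonneg
  constructor
  · rintro (_ | _ | i)
    · rw [coeff_quadratic_mul_zero]; have := n 0; positivity
    · rw [coeff_quadratic_mul_one]; have := n 0; have := n 1; positivity
    · rw [coeff_quadratic_mul_add_two]
      have := n i; have := n (i + 1); have := n (i + 2); positivity
  · rw [coeff_quadratic_mul_zero]; have := h.pos; positivity
  · rintro (_ | _ | i) h0
    · rw [coeff_quadratic_mul_zero] at h0
      have := mul_pos hC h.pos
      linarith
    · rw [zero_add, coeff_quadratic_mul_one] at h0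
      have := mul_pos hB h.pos
      have := mul_nonneg hC.le (n 1)
      linarith
    · rw [coeff_quadratic_mul_add_two] at h0
      have e1 := mul_nonneg hA (n i)
      have e2 := mul_nonneg hB.le (n (i + 1))
      have e3 := mul_nonneg hC.le (n (i + 2))
      have f2 : p.coeff (i + 1) = 0 := by
        have : B * p.coeff (i + 1) = 0 := by linarith
        simpa [hB.ne'] using this
      have f3 := h.zero_succ _ f2
      have f4 := h.zero_succ _ f3
      rw [coeff_quadratic_mul_add_two, f2, f3, f4]
      simp
  -- For the two lowest indices the missing coefficients of `p` are read as 0.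
  · rintro (_ | _ | i)
    · rw [zero_add, zero_add, coeff_quadratic_mul_zero, coeff_quadratic_mul_one,
        coeff_quadratic_mul_add_two]
      have := concave_combination (e := 0) (x := 0) hA hB.le hC.le hABC (by simp) (by simp)
        (by simpa using sq_nonneg (p.coeff 0)) (by simp) (by simpa using mul_nonneg (n 0) (n 1))
        (h.concave 0)
      simpa using this
    · rw [zero_add, coeff_quadratic_mul_one, coeff_quadratic_mul_add_two, coeff_quadratic_mul_add_two]
      have := concave_combination (e := 0) hA hB.le hC.le hABC
        (by simpa using sq_nonneg (p.coeff 0)) (by simpa using mul_nonneg (n 0) (n 1))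
        (h.concave 0) (by simpa using mul_nonneg (n 0) (n 2)) (h.mul_le 0 1) (h.concave 1)
      simpa using this
    · rw [coeff_quadratic_mul_add_two, coeff_quadratic_mul_add_two,
        show i + 1 + 1 + 1 = i + 1 + 2 by ring, coeff_quadratic_mul_add_two]
      refine concave_combination hA hB.le hC.le hABC (h.concave i) (h.mul_le i 1) (h.concave _)
        (h.mul_le i 2) (h.mul_le (i + 1) 1) (h.concave _)

theorem coeff_linear_mul_zero (u v : ℝ) (p : ℝ[X]) :
    ((C v * X + C u) * p).coeff 0 = u * p.coeff 0 := by
  simp [mul_coeff_zero]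

theorem coeff_linear_mul_succ (u v : ℝ) (p : ℝ[X]) (k : ℕ) :
    ((C v * X + C u) * p).coeff (k + 1) = v * p.coeff k + u * p.coeff (k + 1) := by
  have : (C v * X + C u) * p = C v * (X * p) + C u * p := by ring
  simp only [this, coeff_add, coeff_C_mul, coeff_X_mul]

theorem LogConcave.signVariations_eq_zero {p : ℝ[X]} (h : LogConcave p) : p.signVariations = 0 :=
  signVariations_eq_zero_of_nonneg h.nonneg

/-- For `u < 0 ≤ v` the sign of `v p_k + u p_{k+1}` depends on the ratio `p_k / p_{k+1}`, which
grows with `k`. Hence the signs change from negative to nonnegative at most once. -/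
theorem LogConcave.signVariations_linear_mul_le {p : ℝ[X]} (h : LogConcave p) (u v : ℝ) :
    ((C v * X + C u) * p).signVariations ≤ 1 := by
  wlog hv : 0 ≤ v generalizing u v
  · have := this (-u) (-v) (by linarith)
    rwa [show (C (-v) * X + C (-u)) * p = -((C v * X + C u) * p) by simp only [C_neg]; ring,
      signVariations_neg] at this
  rcases le_or_gt 0 u with hu | hu
  · rw [signVariations_eq_zero_of_nonneg]
    · exact zero_le_one
    rintro (_ | k)
    · rw [coeff_linear_mul_zero]; exact mul_nonneg hu (h.nonneg 0)
    · rw [coeff_linear_mul_succ]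
      exact add_nonneg (mul_nonneg hv (h.nonneg k)) (mul_nonneg hu (h.nonneg _))
  refine signVariations_le_one_of_nonneg_of_le ?_
  have step : ∀ k, 0 ≤ ((C v * X + C u) * p).coeff k →
      0 ≤ ((C v * X + C u) * p).coeff (k + 1) := by
    rintro (_ | k) h0
    · rw [coeff_linear_mul_zero] at h0
      exact absurd h0 (not_le.mpr (mul_neg_of_neg_of_pos hu h.pos))
    · rw [coeff_linear_mul_succ] at h0 ⊢
      rcases (h.nonneg (k + 1)).eq_or_lt with e | e
      · rw [h.zero_succ _ e.symm]
        simpa using mul_nonneg hv (h.nonneg _)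
      -- Multiplied by `p_{k+1}`, the next coefficient is at least `(v p_k + u p_{k+1}) p_{k+2}`.
      · have hc := h.concave k
        refine nonneg_of_mul_nonneg_left (b := p.coeff (k + 1)) ?_ e
        have a1 := mul_le_mul_of_nonneg_left hc hv
        have a2 := mul_nonneg h0 (h.nonneg (k + 2))
        rw [show k + 1 + 1 = k + 2 by ring]
        linarith
  intro i j hij
  induction j, hij using Nat.le_induction with
  | base => exact id
  | succ j _ ih => exact fun h0 => step j (ih h0)

/-- If all complex roots of `p` have distance at least `b - a` from the midpoint of `(a, b)`, the
Möbius transform of `p` is, up to a constant factor, log-concave. -/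
theorem exists_logConcave_of_roots_far {a b : ℝ} (hab : a < b) {p : ℝ[X]} (hp : p ≠ 0)
    (h : ∀ z : ℂ, aeval z p = 0 → b - a ≤ ‖z - ((a + b) / 2 : ℝ)‖) :
    ∃ c q, c ≠ 0 ∧ LogConcave q ∧ realMoebius p.natDegree p a b = C c * q := by
  induction hn : p.natDegree using Nat.strong_induction_on generalizing p with | _ n ih =>
  rcases Nat.eq_zero_or_pos n with h0 | h0
  · subst h0
    refine ⟨p.coeff 0, 1, ?_, LogConcave.one, ?_⟩
    · rw [eq_C_of_natDegree_eq_zero hn] at hp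
      simpa using hp
    · simp [realMoebius]
  obtain ⟨z, hz⟩ : ∃ z : ℂ, aeval z p = 0 :=
    IsAlgClosed.exists_aeval_eq_zero _ p (by
      rw [← hn] at h0; exact (natDegree_pos_iff_degree_pos.mp h0).ne')
  have hzd := h z hz
  have hD : (b - a) ^ 2 ≤ (z.re - (a + b) / 2) ^ 2 + z.im ^ 2 := by
    have h1 : ‖z - ((a + b) / 2 : ℝ)‖ ^ 2 = (z.re - (a + b) / 2) ^ 2 + z.im ^ 2 := by
      rw [← Complex.normSq_eq_norm_sq, Complex.normSq_apply]
      simp only [Complex.sub_re, Complex.sub_im, Complex.ofReal_re, Complex.ofReal_im]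
      ring
    rw [← h1]
    have : 0 ≤ b - a := by linarith
    gcongr
  by_cases him : z.im = 0
  · have hzr : z = (z.re : ℂ) := Complex.ext rfl (by simp [him])
    set r := z.re with hr
    have hroot : p.eval r = 0 := by
      have := hz
      rw [hzr, show ((r : ℝ) : ℂ) = algebraMap ℝ ℂ r from rfl,
        aeval_algebraMap_apply] at this
      simpa using this
    obtain ⟨q, rfl⟩ := dvd_iff_isRoot.mpr hroot
    have hq : q ≠ 0 := right_ne_zero_of_mul hp
    have hdeg : ((X - C r) * q).natDegree = 1 + q.natDegree := by
      rw [natDegree_mul (X_sub_C_ne_zero r) hq, natDegree_X_sub_C]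
    obtain ⟨c, s, hc, hs, e⟩ := ih q.natDegree (by omega) hq
      (fun w hw => h w (by rw [map_mul, hw, mul_zero])) rfl
    have hfac : realMoebius n ((X - C r) * q) a b =
        (C 0 * X ^ 2 + C (b - r) * X + C (a - r)) * (C c * s) := by
      rw [← hn, hdeg, realMoebius_mul (natDegree_X_sub_C_le r) le_rfl, realMoebius_linear, e]
      simp
    rw [him] at hD
    -- A real root this far from the midpoint lies outside `[a, b]`, so `a - r` and `b - r` have the
    -- same sign; a negative sign is moved into the constant.
    rcases le_or_gt r ((a + b) / 2) with hle | hgt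
    · have h1 : 0 < a - r := by nlinarith
      refine ⟨c, _, hc, hs.quadratic_mul (A := 0) (B := b - r) le_rfl (by linarith) h1 ?_, ?_⟩
      · rw [zero_mul]; positivity
      · rw [hfac]; ring
    · have h1 : 0 < r - b := by nlinarith
      refine ⟨-c, _, neg_ne_zero.mpr hc,
        hs.quadratic_mul (A := 0) (B := r - b) (C' := r - a) le_rfl h1 (by linarith) ?_, ?_⟩
      · rw [zero_mul]; positivity
      · rw [hfac]; simp only [C_neg, C_sub, C_0]; ring
  · obtain ⟨q, hq'⟩ := quadratic_dvd_of_aeval_eq_zero_im_ne_zero p hz him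
    have hq : q ≠ 0 := by rintro rfl; simp at hq'; exact hp hq'
    have hquad : (X ^ 2 - C (2 * z.re) * X + C (‖z‖ ^ 2) : ℝ[X]).natDegree = 2 := by
      compute_degree!
    have hquad0 : (X ^ 2 - C (2 * z.re) * X + C (‖z‖ ^ 2) : ℝ[X]) ≠ 0 := by
      intro h0; rw [h0] at hquad; simp at hquad
    have hdeg : n = 2 + q.natDegree := by
      rw [← hn]
      conv_lhs => rw [hq']
      rw [natDegree_mul hquad0 hq, hquad]
    obtain ⟨c, s, hc, hs, e⟩ := ih q.natDegree (by omega) hq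
      (fun w hw => h w (by rw [hq', map_mul, hw, mul_zero])) rfl
    have hnorm : ‖z‖ ^ 2 = z.re ^ 2 + z.im ^ 2 := by
      rw [← Complex.normSq_eq_norm_sq, Complex.normSq_apply]; ring
    refine ⟨c, _, hc, hs.quadratic_mul (A := b ^ 2 - 2 * z.re * b + ‖z‖ ^ 2)
      (B := 2 * a * b - 2 * z.re * (a + b) + 2 * ‖z‖ ^ 2)
      (C' := a ^ 2 - 2 * z.re * a + ‖z‖ ^ 2) ?_ ?_ ?_ ?_, ?_⟩
    · rw [hnorm]; nlinarith [sq_nonneg (z.re - b), sq_nonneg z.im]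
    · rw [hnorm]; nlinarith [sq_pos_of_pos (sub_pos.mpr hab)]
    · have := sq_pos_of_ne_zero him
      rw [hnorm]; nlinarith [sq_nonneg (z.re - a)]
    · rw [hnorm]
      -- With `D` the squared distance to the midpoint and `e` the squared half-length, the outer
      -- coefficients sum to `2 (D + e)` and the middle one is `2 (D - e)`. By AM-GM it suffices
      -- that `D + e ≤ 2 (D - e)`, that is `3 e ≤ D`; the distance hypothesis gives `4 e ≤ D`.
      set D := (z.re - (a + b) / 2) ^ 2 + z.im ^ 2 with hDdef
      set e := ((b - a) / 2) ^ 2 with he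
      set A := b ^ 2 - 2 * z.re * b + (z.re ^ 2 + z.im ^ 2) with hA
      set C' := a ^ 2 - 2 * z.re * a + (z.re ^ 2 + z.im ^ 2) with hC'
      have e1 : A + C' = 2 * (D + e) := by rw [hA, hC', hDdef, he]; ring
      have e2 : 2 * a * b - 2 * z.re * (a + b) + 2 * (z.re ^ 2 + z.im ^ 2) = 2 * (D - e) := by
        rw [hDdef, he]; ring
      have e3 : 4 * e ≤ D := by rw [he]; linarith
      have e4 : 0 ≤ e := sq_nonneg _
      rw [e2]
      have : A * C' ≤ (D + e) ^ 2 := by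
        have := four_mul_le_sq_add A C'
        nlinarith
      have h5 : D + e ≤ 2 * (D - e) := by linarith
      have h6 : 0 ≤ D + e := by linarith
      exact this.trans (by gcongr)
    · have : realMoebius n p a b = realMoebius (2 + q.natDegree)
          ((X ^ 2 - C (2 * z.re) * X + C (‖z‖ ^ 2)) * q) a b := by rw [← hq', hdeg]
      rw [this, realMoebius_mul hquad.le le_rfl, realMoebius_quadratic, e]
      ring

/-- At most one sign variation occurs unless two distinct complex roots are close to the
midpoint of the interval. -/
theorem signVariations_realMoebius_le_one {a b : ℝ} (hab : a < b) {p : ℝ[X]}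
    (hp : p.Separable)
    (h : ∀ z w : ℂ, aeval z p = 0 → aeval w p = 0 → ‖z - ((a + b) / 2 : ℝ)‖ < b - a →
      ‖w - ((a + b) / 2 : ℝ)‖ < b - a → z = w) :
    (realMoebius p.natDegree p a b).signVariations ≤ 1 := by
  by_cases hfar : ∀ z : ℂ, aeval z p = 0 → b - a ≤ ‖z - ((a + b) / 2 : ℝ)‖
  · obtain ⟨c, q, hc, hq, e⟩ := exists_logConcave_of_roots_far hab hp.ne_zero hfar
    rw [e, signVariations_C_mul _ hc, hq.signVariations_eq_zero]
    exact zero_le_one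
  push Not at hfar
  obtain ⟨z, hz, hzd⟩ := hfar
  have hconj : aeval ((starRingEnd ℂ) z) p = 0 := by rw [aeval_conj, hz, map_zero]
  -- The midpoint is real, so the conjugate root is equally close; being the only close root, `z` is
  -- real.
  have him : (starRingEnd ℂ) z = z := by
    refine h _ _ hconj hz ?_ hzd
    have : (starRingEnd ℂ) z - ((a + b) / 2 : ℝ) = (starRingEnd ℂ) (z - ((a + b) / 2 : ℝ)) := by
      rw [map_sub, Complex.conj_ofReal]
    rwa [this, Complex.norm_conj]
  obtain ⟨r, rfl⟩ := Complex.conj_eq_iff_real.mp him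
  have hroot : p.eval r = 0 := by
    rw [show ((r : ℝ) : ℂ) = algebraMap ℝ ℂ r from rfl, aeval_algebraMap_apply] at hz
    simpa using hz
  obtain ⟨q, rfl⟩ := dvd_iff_isRoot.mpr hroot
  have hq : q ≠ 0 := right_ne_zero_of_mul hp.ne_zero
  -- The root is simple, so the cofactor has only far roots and its transform is log-concave up to a
  -- constant.
  have hqr : aeval (r : ℂ) q ≠ 0 := by
    intro h0
    rw [show ((r : ℝ) : ℂ) = algebraMap ℝ ℂ r from rfl, aeval_algebraMap_apply] at h0
    have h1 : q.eval r = 0 := by simpa using h0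
    obtain ⟨s, rfl⟩ := dvd_iff_isRoot.mpr h1
    have := hp.squarefree (X - C r) ⟨s, by ring⟩
    exact not_isUnit_X_sub_C r this
  obtain ⟨c, s, hc, hs, e⟩ := exists_logConcave_of_roots_far hab hq (fun w hw => by
    by_contra hlt
    have := h w r (by rw [map_mul, hw, mul_zero]) hz (not_le.mp hlt) hzd
    exact hqr (this ▸ hw))
  have hdeg : ((X - C r) * q).natDegree = 1 + q.natDegree := by
    rw [natDegree_mul (X_sub_C_ne_zero r) hq, natDegree_X_sub_C]
  rw [hdeg, realMoebius_mul (natDegree_X_sub_C_le r) le_rfl, realMoebius_linear, e,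
    show ∀ l : ℝ[X], l * (C c * s) = C c * (l * s) by intro l; ring, signVariations_C_mul _ hc]
  exact hs.signVariations_linear_mul_le _ _

/-! ### Correctness of the subdivision -/

theorem descartesVar_eq (P : ℤ[X]) (a b : ℚ) :
    descartesVar P a b =
      (realMoebius P.natDegree (P.map (algebraMap ℤ ℝ)) a b).signVariations := by
  rw [← map_moebius, signVariations_map_ratCast, descartesVar]

theorem eval_map_eq_aeval (P : ℤ[X]) (x : ℝ) : (P.map (algebraMap ℤ ℝ)).eval x = aeval x P := by
  simp [aeval_def, eval₂_eq_eval_map]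

theorem natDegree_map_real_le (P : ℤ[X]) : (P.map (algebraMap ℤ ℝ)).natDegree ≤ P.natDegree :=
  natDegree_map_le

theorem eval_realMoebius_eq_zero_iff (P : ℤ[X]) (a b : ℝ) {z : ℝ} (hz : 0 < z) :
    (realMoebius P.natDegree (P.map (algebraMap ℤ ℝ)) a b).eval z = 0 ↔
      aeval ((a + b * z) / (1 + z)) P = 0 := by
  have hz' : 1 + z ≠ 0 := by positivity
  rw [eval_realMoebius (natDegree_map_real_le P) _ _ hz', eval_map_eq_aeval]
  simp [hz']

theorem moebius_inverse {a b x : ℝ} (h1 : a < x) (h2 : x < b) :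
    (a + b * ((x - a) / (b - x))) / (1 + (x - a) / (b - x)) = x := by
  have hbx : 0 < b - x := sub_pos.mpr h2
  have hz : 0 < (x - a) / (b - x) := div_pos (sub_pos.mpr h1) hbx
  rw [div_eq_iff (by positivity)]
  field_simp
  ring

theorem realMoebius_ne_zero {P : ℤ[X]} (hP : P ≠ 0) {a b : ℝ} (hab : a < b) :
    realMoebius P.natDegree (P.map (algebraMap ℤ ℝ)) a b ≠ 0 := by
  intro h0
  apply hP
  apply map_injective _ (algebraMap ℤ ℝ).injective_int
  rw [Polynomial.map_zero]
  refine eq_of_infinite_eval_eq _ _ ((Set.Ioo_infinite hab).mono fun x hx => ?_)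
  have hbx : 0 < b - x := sub_pos.mpr hx.2
  have hax : 0 < x - a := sub_pos.mpr hx.1
  have := (eval_realMoebius_eq_zero_iff P a b (div_pos hax hbx)).mp (by rw [h0, eval_zero])
  rw [moebius_inverse hx.1 hx.2] at this
  rw [Set.mem_ofPred_eq, eval_map_eq_aeval, this, eval_zero]

/-- The substitution `x ↦ (x - a) / (b - x)` sends roots in `(a, b)` injectively to positive roots
of the transform, to which Descartes' rule applies. -/
theorem card_roots_le_descartesVar {P : ℤ[X]} (hP : P ≠ 0) {a b : ℚ} (hab : a < b)
    (S : Finset ℝ) (hS : ∀ x ∈ S, (a : ℝ) < x ∧ x < b ∧ aeval x P = 0) :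
    S.card ≤ descartesVar P a b := by
  rw [descartesVar_eq]
  refine le_trans ?_ (roots_countP_pos_le_signVariations _)
  set Q := realMoebius P.natDegree (P.map (algebraMap ℤ ℝ)) a b with hQdef
  have hQ : Q ≠ 0 := realMoebius_ne_zero hP (by exact_mod_cast hab)
  rw [Multiset.countP_eq_card_filter]
  refine le_trans ?_ (Multiset.toFinset_card_le _)
  refine Finset.card_le_card_of_injOn (fun x => (x - a) / (b - x)) ?_ ?_
  · intro x hx
    obtain ⟨h1, h2, h3⟩ := hS x hx
    have hbx : (0 : ℝ) < b - x := sub_pos.mpr h2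
    have hax : 0 < x - a := sub_pos.mpr h1
    have hz := div_pos hax hbx
    simp only [Finset.mem_coe, Multiset.mem_toFinset, Multiset.mem_filter]
    refine ⟨?_, hz⟩
    rw [mem_roots hQ, IsRoot, hQdef, eval_realMoebius_eq_zero_iff P _ _ hz]
    rwa [moebius_inverse h1 h2]
  · intro x hx y hy e
    obtain ⟨h1, h2, -⟩ := hS x hx
    obtain ⟨h3, h4, -⟩ := hS y hy
    have : (b : ℝ) - x ≠ 0 := by linarith
    have : (b : ℝ) - y ≠ 0 := by linarith
    have hba : (b : ℝ) - a ≠ 0 := by linarith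
    simp only at e
    field_simp at e
    have : ((b : ℝ) - a) * (x - y) = 0 := by linear_combination e
    rcases mul_eq_zero.mp this with h | h
    · exact absurd h hba
    · linarith

theorem exists_root_of_descartesVar_eq_one {P : ℤ[X]} {a b : ℚ} (hab : a < b)
    (h : descartesVar P a b = 1) : ∃ x : ℝ, (a : ℝ) < x ∧ x < b ∧ aeval x P = 0 := by
  rw [descartesVar_eq] at h
  obtain ⟨z, hz, hz0⟩ := exists_pos_root_of_signVariations_eq_one h
  have hab' : (a : ℝ) < b := by exact_mod_cast hab
  have hz' : 0 < 1 + z := by positivity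
  refine ⟨_, ?_, ?_, (eval_realMoebius_eq_zero_iff P a b hz).mp hz0⟩
  · rw [lt_div_iff₀ hz']; nlinarith
  · rw [div_lt_iff₀ hz']; nlinarith

/-- What the subdivision of `(a, b)` achieves. -/
structure IsolatesIn (P : ℤ[X]) (a b : ℚ) (L : List (ℚ × ℚ)) : Prop where
  nodup : L.Nodup
  unique_root : ∀ I ∈ L, ∃! x : ℝ, InIv I x ∧ aeval x P = 0
  unique_iv : ∀ x : ℝ, (a : ℝ) < x → x < b → aeval x P = 0 → ∃! I, I ∈ L ∧ InIv I x
  subset : ∀ I ∈ L, ∀ x : ℝ, InIv I x → (a : ℝ) < x ∧ x < b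

theorem IsolatesIn.append {P : ℤ[X]} {a m b : ℚ} (ham : a < m) (hmb : m < b)
    {L₁ L₂ : List (ℚ × ℚ)} (h₁ : IsolatesIn P a m L₁) (h₂ : IsolatesIn P m b L₂) :
    IsolatesIn P a b (L₁ ++ (if aeval m P = 0 then [(m, m)] else []) ++ L₂) := by
  have ham' : (a : ℝ) < m := by exact_mod_cast ham
  have hmb' : (m : ℝ) < b := by exact_mod_cast hmb
  set M : List (ℚ × ℚ) := if aeval m P = 0 then [(m, m)] else [] with hM
  have hroot : aeval (m : ℝ) P = 0 ↔ aeval m P = 0 := by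
    rw [show (m : ℝ) = algebraMap ℚ ℝ m from rfl, aeval_algebraMap_apply]
    simp
  have hpt : ∀ x : ℝ, InIv (m, m) x ↔ x = m := by
    intro x
    constructor
    · rintro (⟨h, h'⟩ | ⟨h, h'⟩)
      · exact absurd (h.trans h') (lt_irrefl _)
      · exact h'
    · rintro rfl; exact Or.inr ⟨rfl, rfl⟩
  have hMmem : ∀ I ∈ M, I = (m, m) ∧ aeval (m : ℝ) P = 0 := by
    intro I hI
    rw [hM] at hI
    split_ifs at hI with h0
    · exact ⟨by simpa using hI, hroot.mpr h0⟩
    · simp at hI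
  have hmem : ∀ I, I ∈ L₁ ++ M ++ L₂ ↔ I ∈ L₁ ∨ I ∈ M ∨ I ∈ L₂ := by
    intro I; simp
  have side : ∀ I ∈ L₁ ++ M ++ L₂, ∀ x : ℝ, InIv I x →
      (I ∈ L₁ ∧ (a : ℝ) < x ∧ x < m) ∨ (I ∈ M ∧ x = m) ∨ (I ∈ L₂ ∧ (m : ℝ) < x ∧ x < b) := by
    intro I hI x hx
    rcases (hmem I).mp hI with h | h | h
    · exact Or.inl ⟨h, h₁.subset I h x hx⟩
    · exact Or.inr (Or.inl ⟨h, (hpt x).mp ((hMmem I h).1 ▸ hx)⟩)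
    · exact Or.inr (Or.inr ⟨h, h₂.subset I h x hx⟩)
  have uniq : ∀ I ∈ L₁ ++ M ++ L₂, ∃! x : ℝ, InIv I x ∧ aeval x P = 0 := by
    intro I hI
    rcases (hmem I).mp hI with h | h | h
    · exact h₁.unique_root I h
    · obtain ⟨rfl, h0⟩ := hMmem I h
      exact ⟨m, ⟨(hpt _).mpr rfl, h0⟩, fun y hy => (hpt y).mp hy.1⟩
    · exact h₂.unique_root I h
  refine ⟨?_, uniq, ?_, ?_⟩
  -- Every listed interval contains a point, and the left half, the midpoint and the right half are
  -- disjoint, so no entry is shared.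
  · rw [List.nodup_append', List.nodup_append']
    refine ⟨⟨h₁.nodup, ?_, ?_⟩, h₂.nodup, ?_⟩
    · rw [hM]; split_ifs <;> simp
    · intro I hI hI'
      obtain ⟨x, ⟨hx, -⟩, -⟩ := h₁.unique_root I hI
      have e1 := h₁.subset I hI x hx
      have e2 := (hpt x).mp ((hMmem I hI').1 ▸ hx)
      linarith [e1.2]
    · intro I hI hI'
      obtain ⟨x, ⟨hx, -⟩, -⟩ := h₂.unique_root I hI'
      have e1 := h₂.subset I hI' x hx
      rcases List.mem_append.mp hI with h | h
      · linarith [(h₁.subset I h x hx).2, e1.1]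
      · have e2 := (hpt x).mp ((hMmem I h).1 ▸ hx)
        linarith [e1.1]
  · intro x hax hxb hx
    rcases lt_trichotomy x m with hlt | rfl | hgt
    · obtain ⟨I, ⟨hI, hI'⟩, hu⟩ := h₁.unique_iv x hax hlt hx
      refine ⟨I, ⟨(hmem I).mpr (Or.inl hI), hI'⟩, fun J hJ => hu J ⟨?_, hJ.2⟩⟩
      rcases side J hJ.1 x hJ.2 with h | h | h
      · exact h.1
      · linarith [h.2]
      · linarith [h.2.1]
    · refine ⟨(m, m), ⟨(hmem _).mpr (Or.inr (Or.inl ?_)), (hpt _).mpr rfl⟩, fun J hJ => ?_⟩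
      · rw [hM, if_pos (hroot.mp hx)]; simp
      · rcases side J hJ.1 m hJ.2 with h | h | h
        · linarith [h.2.2]
        · exact (hMmem J h.1).1
        · linarith [h.2.1]
    · obtain ⟨I, ⟨hI, hI'⟩, hu⟩ := h₂.unique_iv x hgt hxb hx
      refine ⟨I, ⟨(hmem I).mpr (Or.inr (Or.inr hI)), hI'⟩, fun J hJ => hu J ⟨?_, hJ.2⟩⟩
      rcases side J hJ.1 x hJ.2 with h | h | h
      · linarith [h.2.2]
      · linarith [h.2]
      · exact h.1
  · intro I hI x hx
    rcases side I hI x hx with h | h | h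
    · exact ⟨h.2.1, h.2.2.trans hmb'⟩
    · rw [h.2]; exact ⟨ham', hmb'⟩
    · exact ⟨ham'.trans h.2.1, h.2.2⟩

/-- Correctness of a finished run needs no separability, which matters only for termination and
cost. -/
theorem Subdivide.isolatesIn {P : ℤ[X]} (hP : P ≠ 0) {a b : ℚ} {L : List (ℚ × ℚ)} {n : ℕ}
    (h : Subdivide P a b L n) (hab : a < b) : IsolatesIn P a b L := by
  induction h with
  | discard a b h =>
    refine ⟨List.nodup_nil, by simp, fun x h1 h2 h3 => ?_, by simp⟩
    have := card_roots_le_descartesVar hP hab {x} (by simp [h1, h2, h3])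
    simp [h] at this
  | report a b h =>
    have hab' : (a : ℝ) < b := by exact_mod_cast hab
    have hiv : ∀ x : ℝ, InIv (a, b) x ↔ (a : ℝ) < x ∧ x < b := by
      intro x
      constructor
      · rintro (h | ⟨h, h'⟩)
        · exact h
        · exact absurd (h.trans h') hab'.ne
      · exact Or.inl
    refine ⟨List.nodup_singleton _, ?_, ?_, ?_⟩
    · intro I hI
      obtain rfl := List.mem_singleton.mp hI
      obtain ⟨x, h1, h2, h3⟩ := exists_root_of_descartesVar_eq_one hab h
      refine ⟨x, ⟨(hiv x).mpr ⟨h1, h2⟩, h3⟩, fun y hy => ?_⟩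
      by_contra hne
      have hy' := (hiv y).mp hy.1
      have := card_roots_le_descartesVar hP hab {y, x} (by
        intro w hw
        rcases Finset.mem_insert.mp hw with rfl | hw
        · exact ⟨hy'.1, hy'.2, hy.2⟩
        · rw [Finset.mem_singleton.mp hw]; exact ⟨h1, h2, h3⟩)
      rw [Finset.card_pair hne, h] at this
      omega
    · intro x h1 h2 _
      exact ⟨(a, b), ⟨List.mem_singleton.mpr rfl, (hiv x).mpr ⟨h1, h2⟩⟩,
        fun J hJ => List.mem_singleton.mp hJ.1⟩
    · intro I hI x hx
      obtain rfl := List.mem_singleton.mp hI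
      exact (hiv x).mp hx
  | bisect a b L₁ L₂ n₁ n₂ h _ _ ih₁ ih₂ =>
    have h1 : a < (a + b) / 2 := by linarith
    have h2 : (a + b) / 2 < b := by linarith
    exact (ih₁ h1).append h1 h2 (ih₂ h2)

/-- Cauchy's bound; a nonzero integer leading coefficient has absolute value at least 1, so division
by it can be dropped. -/
theorem abs_lt_of_root {P : ℤ[X]} (hP : P ≠ 0) {x : ℝ} (hx : aeval x P = 0) :
    |x| < 1 + height P := by
  set p := P.map (algebraMap ℤ ℝ) with hp
  have hinj : Function.Injective (algebraMap ℤ ℝ) := (algebraMap ℤ ℝ).injective_int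
  have hp0 : p ≠ 0 := (Polynomial.map_ne_zero_iff hinj).mpr hP
  have hroot : p.IsRoot x := by rw [IsRoot, hp, eval_map_eq_aeval, hx]
  have hlt := IsRoot.norm_lt_cauchyBound hp0 hroot
  have hle : cauchyBound p ≤ height P + 1 := by
    rw [cauchyBound]
    gcongr
    have hlc : 1 ≤ ‖p.leadingCoeff‖₊ := by
      rw [hp, leadingCoeff_map_of_injective hinj, ← NNReal.coe_le_coe, coe_nnnorm]
      simp only [algebraMap_int_eq, eq_intCast, NNReal.coe_one, Real.norm_eq_abs]
      exact_mod_cast Int.one_le_abs (leadingCoeff_ne_zero.mpr hP)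
    refine (div_le_self (zero_le) hlc).trans (Finset.sup_le fun i _ => ?_)
    rw [← NNReal.coe_le_coe, coe_nnnorm, hp, coeff_map]
    simp only [algebraMap_int_eq, eq_intCast, NNReal.coe_natCast, Real.norm_eq_abs]
    by_cases hi : P.coeff i = 0
    · simp [hi]
    · have : (P.coeff i).natAbs ≤ height P :=
        Finset.le_sup (f := fun i => (P.coeff i).natAbs) (mem_support_iff.mpr hi)
      rw [← Int.cast_abs, Int.abs_eq_natAbs]
      exact_mod_cast this
  have h2 : ‖x‖₊ < (height P : NNReal) + 1 := hlt.trans_le hle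
  have h3 : ‖x‖ < (height P : ℝ) + 1 := by exact_mod_cast h2
  rw [Real.norm_eq_abs] at h3
  linarith

theorem Isolate.isIsolation {P : ℤ[X]} (hP : P ≠ 0) {L : List (ℚ × ℚ)} {n : ℕ}
    (h : Isolate P L n) : IsIsolation P L := by
  cases h with
  | const h =>
    refine ⟨List.nodup_nil, by simp, fun x hx => ?_⟩
    rw [eq_C_of_natDegree_eq_zero h] at hx hP
    simp at hx hP
    exact absurd hx hP
  | run _ _ h hrun =>
    have hpos : (0 : ℚ) < 1 + height P := by positivity
    have := hrun.isolatesIn hP (by linarith)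
    refine ⟨this.nodup, this.unique_root, fun x hx => ?_⟩
    have hx' := abs_lt.mp (abs_lt_of_root hP hx)
    refine this.unique_iv x ?_ ?_ hx
    · push_cast; exact hx'.1
    · push_cast; exact hx'.2

/-! ### One norms and amortized root separation -/

/-- The one norm of a complex polynomial. -/
noncomputable def complexNorm1 (p : ℂ[X]) : ℝ := p.sum fun _ a => ‖a‖

theorem complexNorm1_eq_sum_range {p : ℂ[X]} {n : ℕ} (hn : p.natDegree < n) :
    complexNorm1 p = ∑ i ∈ Finset.range n, ‖p.coeff i‖ :=
  p.sum_over_range' (fun _ => norm_zero) n hn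

theorem complexNorm1_nonneg (p : ℂ[X]) : 0 ≤ complexNorm1 p :=
  Finset.sum_nonneg fun _ _ => norm_nonneg _

theorem complexNorm1_map (P : ℤ[X]) :
    complexNorm1 (P.map (algebraMap ℤ ℂ)) = norm1 P := by
  rw [complexNorm1, Polynomial.sum, norm1,
    support_map_of_injective _ (algebraMap ℤ ℂ).injective_int]
  push_cast
  refine Finset.sum_congr rfl fun i _ => ?_
  rw [coeff_map, Nat.cast_natAbs, algebraMap_int_eq, eq_intCast, Complex.norm_intCast, Int.cast_abs]

theorem norm_eval_le {p : ℂ[X]} {n : ℕ} (hn : p.natDegree ≤ n) (x : ℂ) :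
    ‖p.eval x‖ ≤ complexNorm1 p * max 1 ‖x‖ ^ n := by
  rw [complexNorm1_eq_sum_range (Nat.lt_succ_of_le hn), eval_eq_sum_range' (Nat.lt_succ_of_le hn),
    Finset.sum_mul]
  refine norm_sum_le_of_le _ fun i hi => ?_
  rw [norm_mul, norm_pow]
  gcongr
  calc ‖x‖ ^ i ≤ max 1 ‖x‖ ^ i := by gcongr; exact le_max_right _ _
    _ ≤ max 1 ‖x‖ ^ n := pow_le_pow_right₀ (le_max_left _ _)
        (Nat.lt_succ_iff.mp (Finset.mem_range.mp hi))

theorem complexNorm1_derivative_le {p : ℂ[X]} {n : ℕ} (hn : p.natDegree ≤ n) :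
    complexNorm1 (derivative p) ≤ n * complexNorm1 p := by
  have h1 : (derivative p).natDegree < n + 1 :=
    ((natDegree_derivative_le p).trans (Nat.sub_le _ _)).trans_lt (Nat.lt_succ_of_le hn)
  rw [complexNorm1_eq_sum_range h1,
    complexNorm1_eq_sum_range (show p.natDegree < n + 1 + 1 by omega), Finset.sum_range_succ' _ (n + 1),
    mul_add, Finset.mul_sum]
  refine le_add_of_le_of_nonneg (Finset.sum_le_sum fun i hi => ?_) (by positivity)
  rw [coeff_derivative, norm_mul, mul_comm]
  rcases le_or_gt (i + 1) n with h | h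
  · gcongr
    rw [show (i : ℂ) + 1 = ((i + 1 : ℕ) : ℂ) by push_cast; rfl, Complex.norm_natCast]
    exact_mod_cast h
  · rw [coeff_eq_zero_of_natDegree_lt (lt_of_le_of_lt hn h)]
    simp

theorem one_add_inv_pow_le (d : ℕ) (hd : 0 < d) : (1 + 1 / (d : ℝ)) ^ d ≤ 3 := by
  have h1 : 1 + 1 / (d : ℝ) ≤ Real.exp (1 / d) := by
    rw [add_comm]; exact Real.add_one_le_exp _
  calc (1 + 1 / (d : ℝ)) ^ d ≤ Real.exp (1 / d) ^ d := by gcongr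
    _ = Real.exp 1 := by
      rw [← Real.exp_nat_mul]; congr 1; field_simp
    _ ≤ 3 := by linarith [Real.exp_one_lt_d9]

/-- If `β` is a root close to the root `α`, then the derivative at `α` is small. -/
theorem norm_derivative_le_of_close {p : ℂ[X]} {d : ℕ} (hd : 0 < d) (hp : p.natDegree ≤ d)
    {α β : ℂ} (hα : p.eval α = 0) (hβ : p.eval β = 0) (hne : β ≠ α) (hclose : ‖β - α‖ ≤ 1 / d) :
    ‖p.derivative.eval α‖ ≤ ‖β - α‖ * (3 * d ^ 2 * complexNorm1 p * max 1 ‖α‖ ^ d) := by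
  set δ := ‖β - α‖ with hδ
  have hδ0 : 0 < δ := norm_pos_iff.mpr (sub_ne_zero.mpr hne)
  set K := 3 * d ^ 2 * complexNorm1 p * max 1 ‖α‖ ^ d with hK
  have hd1 : (p.derivative).natDegree ≤ d := (natDegree_derivative_le p).trans (by omega)
  have hd2 : (p.derivative.derivative).natDegree ≤ d :=
    (natDegree_derivative_le _).trans (by omega)
  have hn0 := complexNorm1_nonneg p
  have hn2 : complexNorm1 p.derivative.derivative ≤ d ^ 2 * complexNorm1 p := by
    refine (complexNorm1_derivative_le hd1).trans ?_
    have := complexNorm1_derivative_le hp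
    calc (d : ℝ) * complexNorm1 p.derivative ≤ d * (d * complexNorm1 p) := by gcongr
      _ = _ := by ring
  -- Moving by at most `1 / d` multiplies `max 1 ‖x‖ ^ d` by at most `(1 + 1 / d) ^ d ≤ 3`.
  have hball : ∀ x ∈ Metric.closedBall α δ, ‖p.derivative.derivative.eval x‖ ≤ K := by
    intro x hx
    refine (norm_eval_le hd2 x).trans ?_
    have hx' : ‖x‖ ≤ ‖α‖ + 1 / d := by
      have h1 : ‖x - α‖ ≤ δ := by rw [← dist_eq_norm]; exact hx
      have h2 := norm_le_norm_add_norm_sub α x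
      rw [norm_sub_rev] at h2
      linarith
    have hm : max 1 ‖x‖ ≤ max 1 ‖α‖ * (1 + 1 / d) := by
      have h1 : (1 : ℝ) ≤ max 1 ‖α‖ := le_max_left _ _
      have h2 : ‖α‖ ≤ max 1 ‖α‖ := le_max_right _ _
      have h3 : (0 : ℝ) ≤ 1 / d := by positivity
      apply max_le
      · nlinarith
      · nlinarith
    calc complexNorm1 p.derivative.derivative * max 1 ‖x‖ ^ d
        ≤ (d ^ 2 * complexNorm1 p) * (max 1 ‖α‖ * (1 + 1 / d)) ^ d := by gcongr
      _ = (d ^ 2 * complexNorm1 p) * (max 1 ‖α‖ ^ d * (1 + 1 / d) ^ d) := by rw [mul_pow]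
      _ ≤ (d ^ 2 * complexNorm1 p) * (max 1 ‖α‖ ^ d * 3) := by
        gcongr; exact one_add_inv_pow_le d hd
      _ = K := by rw [hK]; ring
  have hαm : α ∈ Metric.closedBall α δ := Metric.mem_closedBall_self hδ0.le
  have hβm : β ∈ Metric.closedBall α δ := by rw [Metric.mem_closedBall, dist_eq_norm]
  have hK0 : 0 ≤ K := (norm_nonneg _).trans (hball α hαm)
  have h1 : ∀ x ∈ Metric.closedBall α δ, ‖p.derivative.eval x - p.derivative.eval α‖ ≤ K * δ := by
    intro x hx
    have := (convex_closedBall α δ).norm_image_sub_le_of_norm_hasDerivWithin_le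
      (f := fun x => p.derivative.eval x) (f' := fun x => p.derivative.derivative.eval x)
      (fun y _ => (p.derivative.hasDerivAt y).hasDerivWithinAt) hball hαm hx
    refine this.trans ?_
    gcongr
    rw [← dist_eq_norm]; exact hx
  -- The mean value inequality once more, now for `p` minus its linear part at `α`. As `p` vanishes
  -- at both points, it reads `‖p'(α)‖ δ ≤ K δ²`.
  have h2 := (convex_closedBall α δ).norm_image_sub_le_of_norm_hasDerivWithin_le
      (f := fun x => p.eval x - p.derivative.eval α * x)
      (f' := fun x => p.derivative.eval x - p.derivative.eval α) (C := K * δ)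
      (fun y _ => by
        have := (p.hasDerivAt y).fun_sub ((hasDerivAt_id y).const_mul (p.derivative.eval α))
        simpa using this.hasDerivWithinAt) h1 hαm hβm
  simp only [hα, hβ] at h2
  rw [show (0 : ℂ) - p.derivative.eval α * β - (0 - p.derivative.eval α * α)
    = -(p.derivative.eval α * (β - α)) by ring, norm_neg, norm_mul] at h2
  exact le_of_mul_le_mul_right (by linarith) hδ0

/-- Take for `σ` the distance to the nearest other root if this is at most `1 / d`, and `1 / d`
otherwise. In the second case the trivial bound on `p'(α)` suffices. -/
theorem exists_separation_of_root {p : ℂ[X]} {d : ℕ} (hd : 0 < d) (hp : p.natDegree ≤ d)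
    (S : Finset ℂ) (hS : ∀ β ∈ S, p.eval β = 0) {α : ℂ} (hα : α ∈ S) :
    ∃ σ : ℝ, 0 < σ ∧ σ ≤ 1 ∧ (∀ β ∈ S, β ≠ α → σ ≤ ‖β - α‖) ∧
      ‖p.derivative.eval α‖ ≤ σ * (3 * d ^ 2 * complexNorm1 p * max 1 ‖α‖ ^ d) := by
  have hd' : (0 : ℝ) < d := by exact_mod_cast hd
  have hd1 : (1 : ℝ) ≤ d := by exact_mod_cast hd
  by_cases hex : ∃ β ∈ S.erase α, ‖β - α‖ ≤ 1 / d
  · obtain ⟨β₀, hβ₀, hβ₀'⟩ := hex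
    obtain ⟨β, hβ, hmin⟩ := Finset.exists_min_image (S.erase α) (fun β => ‖β - α‖) ⟨β₀, hβ₀⟩
    obtain ⟨hne, hβS⟩ := Finset.mem_erase.mp hβ
    have hle : ‖β - α‖ ≤ 1 / d := (hmin β₀ hβ₀).trans hβ₀'
    refine ⟨‖β - α‖, norm_pos_iff.mpr (sub_ne_zero.mpr hne), hle.trans ?_, ?_, ?_⟩
    · rw [div_le_one hd']; exact hd1
    · intro γ hγ hγα
      exact hmin γ (Finset.mem_erase.mpr ⟨hγα, hγ⟩)
    · exact norm_derivative_le_of_close hd hp (hS α hα) (hS β hβS) hne hle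
  · push Not at hex
    refine ⟨1 / d, by positivity, ?_, ?_, ?_⟩
    · rw [div_le_one hd']; exact hd1
    · intro γ hγ hγα
      exact (hex γ (Finset.mem_erase.mpr ⟨hγα, hγ⟩)).le
    · have hd2 : (p.derivative).natDegree ≤ d := (natDegree_derivative_le p).trans (by omega)
      refine (norm_eval_le hd2 α).trans ?_
      have h1 := complexNorm1_derivative_le hp
      have h0 := complexNorm1_nonneg p
      calc complexNorm1 p.derivative * max 1 ‖α‖ ^ d ≤ d * complexNorm1 p * max 1 ‖α‖ ^ d := by
            gcongr
        _ ≤ 3 * (d * complexNorm1 p * max 1 ‖α‖ ^ d) := by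
            have : 0 ≤ d * complexNorm1 p * max 1 ‖α‖ ^ d := by positivity
            linarith
        _ = _ := by field_simp

/-- The finite set of complex roots. -/
noncomputable def complexRoots (P : ℤ[X]) : Finset ℂ :=
  (P.map (algebraMap ℤ ℂ)).roots.toFinset

theorem mem_complexRoots {P : ℤ[X]} (hP : P ≠ 0) {z : ℂ} : z ∈ complexRoots P ↔ aeval z P = 0 := by
  rw [complexRoots, Multiset.mem_toFinset, mem_roots
    ((Polynomial.map_ne_zero_iff (algebraMap ℤ ℂ).injective_int).mpr hP), IsRoot,
    eval_map_algebraMap]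

theorem card_complexRoots_le (P : ℤ[X]) : (complexRoots P).card ≤ P.natDegree :=
  (Multiset.toFinset_card_le _).trans ((card_roots' _).trans natDegree_map_le)

theorem separable_map_complex {P : ℤ[X]} (h : (P.map (algebraMap ℤ ℚ)).Separable) :
    (P.map (algebraMap ℤ ℂ)).Separable := by
  have := h.map (f := algebraMap ℚ ℂ)
  rwa [Polynomial.map_map, ← IsScalarTower.algebraMap_eq] at this

theorem separable_map_real {P : ℤ[X]} (h : (P.map (algebraMap ℤ ℚ)).Separable) :
    (P.map (algebraMap ℤ ℝ)).Separable := by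
  have := h.map (f := algebraMap ℚ ℝ)
  rwa [Polynomial.map_map, ← IsScalarTower.algebraMap_eq] at this

theorem roots_eq_complexRoots_val {P : ℤ[X]} (h : (P.map (algebraMap ℤ ℚ)).Separable) :
    (P.map (algebraMap ℤ ℂ)).roots = (complexRoots P).val := by
  rw [complexRoots, Multiset.toFinset_val, (nodup_roots (separable_map_complex h)).dedup]

/-- Landau's inequality for the one norm. -/
theorem leadingCoeff_mul_prod_roots_le (P : ℤ[X]) :
    |(P.leadingCoeff : ℝ)| * ((P.map (algebraMap ℤ ℂ)).roots.map fun a => max 1 ‖a‖).prod ≤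
      norm1 P := by
  have h := mahlerMeasure_le_sum_norm_coeff (P.map (algebraMap ℤ ℂ))
  rw [mahlerMeasure_eq_leadingCoeff_mul_prod_roots,
    leadingCoeff_map_of_injective (algebraMap ℤ ℂ).injective_int] at h
  rw [← complexNorm1_map]
  simpa [complexNorm1] using h

/-- The discriminant of an integer polynomial is an integer. -/
theorem one_le_leadingCoeff_pow_mul_prod_derivative {P : ℤ[X]}
    (h : (P.map (algebraMap ℤ ℚ)).Separable) :
    1 ≤ |(P.leadingCoeff : ℝ)| ^ (P.natDegree - 1) *
      ∏ α ∈ complexRoots P, ‖(P.map (algebraMap ℤ ℂ)).derivative.eval α‖ := by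
  set p := P.map (algebraMap ℤ ℂ) with hp
  have hinj : Function.Injective (algebraMap ℤ ℂ) := (algebraMap ℤ ℂ).injective_int
  have hP : P ≠ 0 := by rintro rfl; exact h.ne_zero (by simp)
  have hsep : p.Separable := separable_map_complex h
  have hdeg : p.natDegree = P.natDegree := natDegree_map_eq_of_injective hinj P
  -- The product formula over the roots, with `d - 1` as formal degree of the derivative.
  have hres : ((resultant P P.derivative P.natDegree (P.natDegree - 1) : ℤ) : ℂ) =
      (P.leadingCoeff : ℂ) ^ (P.natDegree - 1) * ∏ α ∈ complexRoots P, p.derivative.eval α := by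
    have h1 := resultant_eq_prod_eval p p.derivative (P.natDegree - 1)
      (by rw [← hdeg]; exact natDegree_derivative_le p) (IsAlgClosed.splits p)
    rw [hdeg, hp, roots_eq_complexRoots_val h, leadingCoeff_map_of_injective hinj, derivative_map,
      resultant_map_map] at h1
    rw [hp, derivative_map]
    simp only [algebraMap_int_eq, eq_intCast] at h1 ⊢
    exact h1
  have hne : resultant P P.derivative P.natDegree (P.natDegree - 1) ≠ 0 := by
    intro h0
    rw [h0, Int.cast_zero] at hres
    rcases mul_eq_zero.mp hres.symm with h1 | h1
    · exact pow_ne_zero _ (by exact_mod_cast leadingCoeff_ne_zero.mpr hP) h1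
    · obtain ⟨α, hα, hα'⟩ := Finset.prod_eq_zero_iff.mp h1
      have hroot : p.eval α = 0 := by
        rw [hp, eval_map_algebraMap]; exact (mem_complexRoots hP).mp hα
      obtain ⟨u, v, huv⟩ := hsep
      have := congrArg (eval α) huv
      simp [hroot, hα'] at this
  have h1 : (1 : ℝ) ≤ ‖((resultant P P.derivative P.natDegree (P.natDegree - 1) : ℤ) : ℂ)‖ := by
    rw [Complex.norm_intCast]
    exact_mod_cast Int.one_le_abs hne
  rw [hres, norm_mul, norm_pow, norm_prod, Complex.norm_intCast] at h1
  exact h1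

theorem norm1_le (P : ℤ[X]) : norm1 P ≤ (P.natDegree + 1) * height P := by
  rw [norm1]
  calc ∑ i ∈ P.support, (P.coeff i).natAbs ≤ ∑ _i ∈ P.support, height P :=
        Finset.sum_le_sum fun i hi => Finset.le_sup (f := fun i => (P.coeff i).natAbs) hi
    _ = P.support.card * height P := by simp
    _ ≤ _ := by gcongr; exact card_supp_le_succ_natDegree P

theorem one_le_height {P : ℤ[X]} (hP : P ≠ 0) : 1 ≤ height P := by
  have h : P.natDegree ∈ P.support := natDegree_mem_support_of_nonzero hP
  refine le_trans ?_ (Finset.le_sup (f := fun i => (P.coeff i).natAbs) h)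
  exact Int.natAbs_pos.mpr (mem_support_iff.mp h)

/-- Amortized root separation: lower bounds for the distances of the roots to their nearest
neighbours, the product of which is not too small. -/
theorem exists_separation {P : ℤ[X]} (hd : 0 < P.natDegree)
    (h : (P.map (algebraMap ℤ ℚ)).Separable) :
    ∃ σ : ℂ → ℝ, (∀ α ∈ complexRoots P, 0 < σ α ∧ σ α ≤ 1 ∧
        ∀ β ∈ complexRoots P, β ≠ α → σ α ≤ ‖β - α‖) ∧
      ∑ α ∈ complexRoots P, Real.logb 2 (1 / σ α) ≤
        P.natDegree * (2 + 4 * Real.logb 2 P.natDegree + 2 * bitsize P) := by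
  have hP : P ≠ 0 := by rintro rfl; simp at hd
  set p := P.map (algebraMap ℤ ℂ) with hp
  set d := P.natDegree with hddef
  have hinj : Function.Injective (algebraMap ℤ ℂ) := (algebraMap ℤ ℂ).injective_int
  have hdeg : p.natDegree = d := natDegree_map_eq_of_injective hinj P
  have hroot : ∀ β ∈ complexRoots P, p.eval β = 0 := fun β hβ => by
    rw [hp, eval_map_algebraMap]; exact (mem_complexRoots hP).mp hβ
  have hex : ∀ α : ℂ, ∃ σ : ℝ, α ∈ complexRoots P → 0 < σ ∧ σ ≤ 1 ∧
      (∀ β ∈ complexRoots P, β ≠ α → σ ≤ ‖β - α‖) ∧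
      ‖p.derivative.eval α‖ ≤ σ * (3 * d ^ 2 * complexNorm1 p * max 1 ‖α‖ ^ d) := by
    intro α
    by_cases hα : α ∈ complexRoots P
    · obtain ⟨σ, hσ⟩ := exists_separation_of_root hd hdeg.le (complexRoots P) hroot hα
      exact ⟨σ, fun _ => hσ⟩
    · exact ⟨0, fun h => absurd h hα⟩
  choose σ hσ using hex
  refine ⟨σ, fun α hα => ⟨(hσ α hα).1, (hσ α hα).2.1, (hσ α hα).2.2.1⟩, ?_⟩
  have hcard : (complexRoots P).card = d := by
    rw [← hdeg, ← (splits_iff_card_roots.mp (IsAlgClosed.splits p)), roots_eq_complexRoots_val h]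
    rfl
  set N : ℝ := (norm1 P : ℝ) with hN
  have hNc : complexNorm1 p = N := complexNorm1_map P
  set a : ℝ := |(P.leadingCoeff : ℝ)| with ha
  have ha1 : 1 ≤ a := by
    rw [ha]; exact_mod_cast Int.one_le_abs (leadingCoeff_ne_zero.mpr hP)
  set m : ℝ := ∏ α ∈ complexRoots P, max 1 ‖α‖ with hm
  have hm1 : 0 < m := Finset.prod_pos fun α _ => lt_max_of_lt_left one_pos
  have hmahler : a * m ≤ N := by
    have := leadingCoeff_mul_prod_roots_le P
    rwa [roots_eq_complexRoots_val h] at this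
  have hN0 : 0 < N := lt_of_lt_of_le (by positivity) hmahler
  have hσ0 : 0 < ∏ α ∈ complexRoots P, σ α := Finset.prod_pos fun α hα => (hσ α hα).1
  have hdpos : (0 : ℝ) < d := by exact_mod_cast hd
  -- The derivative bounds are multiplied over all roots; the factors `max 1 ‖α‖ ^ d` together with
  -- `a ^ d` are absorbed by Landau's inequality.
  have hprod : 1 ≤ (∏ α ∈ complexRoots P, σ α) * (3 * d ^ 2 * N * N) ^ d := by
    calc 1 ≤ a ^ (d - 1) * ∏ α ∈ complexRoots P, ‖p.derivative.eval α‖ :=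
          one_le_leadingCoeff_pow_mul_prod_derivative h
      _ ≤ a ^ d * ∏ α ∈ complexRoots P, (σ α * (3 * d ^ 2 * N * max 1 ‖α‖ ^ d)) := by
        gcongr with α hα
        · omega
        · rw [← hNc]; exact (hσ α hα).2.2.2
      _ = (∏ α ∈ complexRoots P, σ α) * ((3 * d ^ 2 * N) ^ d * (a * m) ^ d) := by
        rw [Finset.prod_mul_distrib, Finset.prod_mul_distrib, Finset.prod_const, hcard,
          Finset.prod_pow, mul_pow a m]
        ring
      _ ≤ (∏ α ∈ complexRoots P, σ α) * ((3 * d ^ 2 * N) ^ d * N ^ d) := by gcongr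
      _ = _ := by rw [← mul_pow]
  have hsum : ∑ α ∈ complexRoots P, Real.logb 2 (1 / σ α) =
      -Real.logb 2 (∏ α ∈ complexRoots P, σ α) := by
    rw [Real.logb_prod _ _ (fun α hα => (hσ α hα).1.ne'), ← Finset.sum_neg_distrib]
    refine Finset.sum_congr rfl fun α _ => ?_
    rw [one_div, Real.logb_inv]
  have hlog : 0 ≤ Real.logb 2 (∏ α ∈ complexRoots P, σ α) +
      d * Real.logb 2 (3 * d ^ 2 * N * N) := by
    rw [← Real.logb_pow, ← Real.logb_mul hσ0.ne' (by positivity)]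
    exact Real.logb_nonneg one_lt_two hprod
  have hH1 : (1 : ℝ) ≤ height P := by exact_mod_cast one_le_height hP
  have hNle : N ≤ (2 * d) * height P := by
    have h1 : (norm1 P : ℝ) ≤ ((d + 1) * height P : ℕ) := by exact_mod_cast norm1_le P
    push_cast at h1
    refine h1.trans ?_
    have : (1 : ℝ) ≤ d := by exact_mod_cast hd
    gcongr
    linarith
  -- The factor 2 from `d + 1 ≤ 2 d` is absorbed by the summand 1 in `bitsize`.
  have hlogN : Real.logb 2 N ≤ Real.logb 2 d + bitsize P := by
    refine (Real.logb_le_logb_of_le one_lt_two hN0 hNle).trans ?_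
    rw [Real.logb_mul (by positivity) (by positivity), Real.logb_mul (by positivity) (by positivity),
      Real.logb_self_eq_one one_lt_two, bitsize]
    linarith
  have hlog3 : Real.logb 2 3 ≤ 2 := by
    rw [Real.logb_le_iff_le_rpow one_lt_two (by norm_num)]; norm_num
  have hexp : Real.logb 2 (3 * d ^ 2 * N * N) ≤ 2 + 4 * Real.logb 2 d + 2 * bitsize P := by
    rw [Real.logb_mul (by positivity) (by positivity), Real.logb_mul (by positivity) (by positivity),
      Real.logb_mul (by positivity) (by positivity), Real.logb_pow]
    push_cast
    linarith
  rw [hsum]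
  have := mul_le_mul_of_nonneg_left hexp hdpos.le
  linarith

/-- Two sign variations on `(a, b)` force two distinct roots close to the midpoint. -/
theorem exists_close_roots_of_two_le_descartesVar {P : ℤ[X]}
    (hsep : (P.map (algebraMap ℤ ℚ)).Separable) {a b : ℚ} (hab : a < b)
    (h : 2 ≤ descartesVar P a b) :
    ∃ α ∈ complexRoots P, ∃ β ∈ complexRoots P, β ≠ α ∧
      ‖α - (((a + b) / 2 : ℝ) : ℂ)‖ < b - a ∧ ‖β - (((a + b) / 2 : ℝ) : ℂ)‖ < b - a := by
  have hP : P ≠ 0 := by rintro rfl; exact hsep.ne_zero (by simp)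
  by_contra hc
  push Not at hc
  have hdeg : (P.map (algebraMap ℤ ℝ)).natDegree = P.natDegree :=
    natDegree_map_eq_of_injective (algebraMap ℤ ℝ).injective_int P
  have hmem : ∀ z : ℂ, aeval z (P.map (algebraMap ℤ ℝ)) = 0 → z ∈ complexRoots P := by
    intro z hz
    rw [mem_complexRoots hP]
    rwa [aeval_map_algebraMap] at hz
  have := signVariations_realMoebius_le_one (a := a) (b := b) (by exact_mod_cast hab)
    (separable_map_real hsep) (fun z w hz hw hz' hw' => by
      by_contra hne
      exact absurd hw' (not_lt.mpr (hc z (hmem z hz) w (hmem w hw) (Ne.symm hne) hz')))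
  rw [hdeg, ← descartesVar_eq] at this
  omega

/-! ### The levels of the subdivision tree -/

/-- The number of intervals with at least two sign variations among the `2 ^ h` parts of
`(a, b)` at depth `h`. -/
noncomputable def levelCount (P : ℤ[X]) (a b : ℚ) (h : ℕ) : ℕ :=
  ((Finset.range (2 ^ h)).filter fun j : ℕ =>
    2 ≤ descartesVar P (a + j * ((b - a) / 2 ^ h)) (a + (j + 1) * ((b - a) / 2 ^ h))).card

theorem levelCount_zero (P : ℤ[X]) (a b : ℚ) :
    levelCount P a b 0 = if 2 ≤ descartesVar P a b then 1 else 0 := by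
  simp [levelCount, Finset.filter_singleton]
  split_ifs <;> simp

theorem levelCount_succ (P : ℤ[X]) (a b : ℚ) (h : ℕ) :
    levelCount P a b (h + 1) =
      levelCount P a ((a + b) / 2) h + levelCount P ((a + b) / 2) b h := by
  simp only [levelCount, Finset.card_filter]
  rw [show 2 ^ (h + 1) = 2 ^ h + 2 ^ h by ring, Finset.sum_range_add]
  refine congrArg₂ (· + ·) (Finset.sum_congr rfl fun j _ => ?_) (Finset.sum_congr rfl fun j _ => ?_)
  · have : (b - a) / 2 ^ (h + 1) = ((a + b) / 2 - a) / 2 ^ h := by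
      rw [pow_succ]; field_simp; ring
    rw [this]
  · have h1 : a + ((2 ^ h + j : ℕ) : ℚ) * ((b - a) / 2 ^ (h + 1)) =
        (a + b) / 2 + j * ((b - (a + b) / 2) / 2 ^ h) := by
      push_cast; rw [pow_succ]; field_simp; ring
    have h2 : a + (((2 ^ h + j : ℕ) : ℚ) + 1) * ((b - a) / 2 ^ (h + 1)) =
        (a + b) / 2 + (j + 1) * ((b - (a + b) / 2) / 2 ^ h) := by
      push_cast; rw [pow_succ]; field_simp; ring
    rw [h1, h2]

/-- A binary tree has one more leaf than inner nodes. The inner nodes are the bisected intervals;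
`levelCount` may also count parts that are never visited, which only weakens the bound. -/
theorem Subdivide.steps_le {P : ℤ[X]} {a b : ℚ} {L : List (ℚ × ℚ)} {n : ℕ}
    (hs : Subdivide P a b L n) {H : ℕ} (hH : ∀ h, H ≤ h → levelCount P a b h = 0) :
    n ≤ 1 + 2 * ∑ h ∈ Finset.range H, levelCount P a b h := by
  induction hs generalizing H with
  | discard => omega
  | report => omega
  | bisect a b L₁ L₂ n₁ n₂ h _ _ ih₁ ih₂ =>
    cases H with
    | zero =>
      have := hH 0 le_rfl
      rw [levelCount_zero, if_pos h] at this
      omega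
    | succ H =>
      have hz : ∀ h, H ≤ h → levelCount P a ((a + b) / 2) h = 0 ∧
          levelCount P ((a + b) / 2) b h = 0 := by
        intro h hh
        have := hH (h + 1) (by omega)
        rw [levelCount_succ] at this
        omega
      have e1 := ih₁ (H := H) (fun h hh => (hz h hh).1)
      have e2 := ih₂ (H := H) (fun h hh => (hz h hh).2)
      rw [Finset.sum_range_succ', levelCount_zero, if_pos h]
      simp only [levelCount_succ, Finset.sum_add_distrib]
      omega

theorem exists_subdivide {P : ℤ[X]} {H : ℕ} {a b : ℚ}
    (hH : ∀ h, H ≤ h → levelCount P a b h = 0) : ∃ L n, Subdivide P a b L n := by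
  induction H generalizing a b with
  | zero =>
    have := hH 0 le_rfl
    rw [levelCount_zero] at this
    have h2 : descartesVar P a b < 2 := by
      by_contra hc
      rw [if_pos (not_lt.mp hc)] at this
      omega
    rcases Nat.eq_zero_or_pos (descartesVar P a b) with h0 | h0
    · exact ⟨_, _, Subdivide.discard a b h0⟩
    · exact ⟨_, _, Subdivide.report a b (by omega)⟩
  | succ H ih =>
    rcases lt_or_ge (descartesVar P a b) 2 with h2 | h2
    · rcases Nat.eq_zero_or_pos (descartesVar P a b) with h0 | h0
      · exact ⟨_, _, Subdivide.discard a b h0⟩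
      · exact ⟨_, _, Subdivide.report a b (by omega)⟩
    · have hz : ∀ h, H ≤ h → levelCount P a ((a + b) / 2) h = 0 ∧
          levelCount P ((a + b) / 2) b h = 0 := by
        intro h hh
        have := hH (h + 1) (by omega)
        rw [levelCount_succ] at this
        omega
      obtain ⟨L₁, n₁, h₁⟩ := ih (fun h hh => (hz h hh).1)
      obtain ⟨L₂, n₂, h₂⟩ := ih (fun h hh => (hz h hh).2)
      exact ⟨_, _, Subdivide.bisect a b L₁ L₂ n₁ n₂ h2 h₁ h₂⟩

theorem card_le_two_of_abs_sub_lt_one (s : Finset ℕ) (x : ℝ) (h : ∀ j ∈ s, |(j : ℝ) - x| < 1) :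
    s.card ≤ 2 := by
  have : (s.map Nat.castEmbedding : Finset ℤ) ⊆ Finset.Icc ⌊x⌋ (⌊x⌋ + 1) := by
    intro k hk
    obtain ⟨j, hj, rfl⟩ := Finset.mem_map.mp hk
    obtain ⟨h1, h2⟩ := abs_lt.mp (h j hj)
    have h3 := Int.floor_le x
    have h4 := Int.lt_floor_add_one x
    simp only [Nat.castEmbedding_apply, Finset.mem_Icc]
    constructor
    · have : ((⌊x⌋ : ℤ) : ℝ) < ((j : ℤ) + 1 : ℤ) := by push_cast; linarith
      have := Int.cast_lt.mp this
      omega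
    · have : (((j : ℤ)) : ℝ) < (⌊x⌋ + 2 : ℤ) := by push_cast; linarith
      have := Int.cast_lt.mp this
      omega
  have := Finset.card_le_card this
  rw [Finset.card_map, Int.card_Icc] at this
  omega

/-- Each counted interval is charged to one of its two close roots `α`, `β`. Both are within `w` of
the midpoint, hence `σ α ≤ ‖β - α‖ < 2 w`. A fixed `α` is charged at most twice, since its real part
is within `w` of midpoints that are spaced by `w`. -/
theorem levelCount_le {P : ℤ[X]} (hsep : (P.map (algebraMap ℤ ℚ)).Separable) {σ : ℂ → ℝ}
    (hσ : ∀ α ∈ complexRoots P, ∀ β ∈ complexRoots P, β ≠ α → σ α ≤ ‖β - α‖)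
    {a b : ℚ} (hab : a < b) (h : ℕ) :
    levelCount P a b h ≤
      2 * ((complexRoots P).filter fun α => σ α < 2 * ((b - a) / 2 ^ h)).card := by
  set w : ℚ := (b - a) / 2 ^ h with hw
  have hw0 : 0 < w := by
    rw [hw]; have : 0 < b - a := sub_pos.mpr hab
    positivity
  have hwr : (0 : ℝ) < w := by exact_mod_cast hw0
  have hwcast : ((b : ℝ) - a) / 2 ^ h = w := by rw [hw]; push_cast; rfl
  -- The number `(α.re - a) / w - 1 / 2` is the real index at which the midpoint would be `α.re`.
  have hex : ∀ j : ℕ, ∃ α : ℂ, 2 ≤ descartesVar P (a + j * w) (a + (j + 1) * w) →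
      α ∈ complexRoots P ∧ σ α < 2 * w ∧ |(j : ℝ) - ((α.re - a) / w - 1 / 2)| < 1 := by
    intro j
    by_cases hj : 2 ≤ descartesVar P (a + j * w) (a + (j + 1) * w)
    · obtain ⟨α, hα, β, hβ, hne, h1, h2⟩ :=
        exists_close_roots_of_two_le_descartesVar hsep (by linarith) hj
      refine ⟨α, fun _ => ⟨hα, ?_, ?_⟩⟩
      · push_cast at h1 h2
        have h3 := norm_sub_le_norm_sub_add_norm_sub β
          (((a : ℂ) + j * w + (a + (j + 1) * w)) / 2) α
        rw [norm_sub_rev (((a : ℂ) + j * w + (a + (j + 1) * w)) / 2) α] at h3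
        have h4 := hσ α hα β hβ hne
        linarith
      · have h3 := (Complex.abs_re_le_norm _).trans_lt h1
        rw [Complex.sub_re, Complex.ofReal_re] at h3
        push_cast at h3
        have e : α.re - ((a : ℝ) + j * w + (a + (j + 1) * w)) / 2 =
            -((j - ((α.re - a) / w - 1 / 2)) * w) := by field_simp; ring
        rw [e, abs_neg, abs_mul, abs_of_pos hwr] at h3
        refine lt_of_mul_lt_mul_right ?_ hwr.le
        linarith
    · exact ⟨0, fun h => absurd h hj⟩
  choose f hf using hex
  rw [levelCount, hwcast]
  refine Finset.card_le_mul_card_image_of_maps_to (f := f) (fun j hj => ?_) 2 (fun α _ => ?_)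
  · have := hf j (Finset.mem_filter.mp hj).2
    exact Finset.mem_filter.mpr ⟨this.1, this.2.1⟩
  · refine card_le_two_of_abs_sub_lt_one _ ((α.re - a) / w - 1 / 2) fun j hj => ?_
    obtain ⟨hj1, hj2⟩ := Finset.mem_filter.mp hj
    have := (hf j (Finset.mem_filter.mp hj1).2).2.2
    rwa [hj2] at this

theorem exists_levelCount_eq_zero {P : ℤ[X]} (hsep : (P.map (algebraMap ℤ ℚ)).Separable)
    {σ : ℂ → ℝ} (hσ0 : ∀ α ∈ complexRoots P, 0 < σ α)
    (hσ : ∀ α ∈ complexRoots P, ∀ β ∈ complexRoots P, β ≠ α → σ α ≤ ‖β - α‖)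
    {a b : ℚ} (hab : a < b) : ∃ H, ∀ h, H ≤ h → levelCount P a b h = 0 := by
  have hab' : (0 : ℝ) < b - a := sub_pos.mpr (by exact_mod_cast hab)
  -- The sum serves as a common upper bound for the ratios `2 (b - a) / σ α`.
  obtain ⟨H, hH⟩ := pow_unbounded_of_one_lt
    (∑ α ∈ complexRoots P, 2 * ((b : ℝ) - a) / σ α) (one_lt_two)
  refine ⟨H, fun h hh => ?_⟩
  have := levelCount_le hsep hσ hab h
  rw [Finset.filter_eq_empty_iff.mpr, Finset.card_empty] at this
  · omega
  intro α hα hlt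
  have h1 : 2 * ((b : ℝ) - a) / σ α ≤ ∑ α ∈ complexRoots P, 2 * ((b : ℝ) - a) / σ α :=
    Finset.single_le_sum (f := fun α => 2 * ((b : ℝ) - a) / σ α)
      (fun β hβ => by have := hσ0 β hβ; positivity) hα
  have h2 : (2 : ℝ) ^ H ≤ 2 ^ h := pow_le_pow_right₀ one_le_two hh
  have h3 : 2 * ((b : ℝ) - a) / σ α < 2 ^ h := by linarith
  rw [div_lt_iff₀ (hσ0 α hα)] at h3
  rw [← mul_div_assoc, lt_div_iff₀ (by positivity)] at hlt
  linarith

theorem card_filter_pow_lt_le {y : ℝ} (hy : 1 ≤ y) (H : ℕ) :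
    (((Finset.range H).filter fun h => (2 : ℝ) ^ h < y).card : ℝ) ≤ 1 + Real.logb 2 y := by
  have h0 : 0 ≤ Real.logb 2 y := Real.logb_nonneg one_lt_two hy
  have hsub : ((Finset.range H).filter fun h => (2 : ℝ) ^ h < y) ⊆
      Finset.range ⌈Real.logb 2 y⌉₊ := by
    intro h hh
    have h1 := (Finset.mem_filter.mp hh).2
    rw [Finset.mem_range, Nat.lt_ceil, Real.lt_logb_iff_rpow_lt one_lt_two (by linarith),
      Real.rpow_natCast]
    exact h1
  have h1 := Finset.card_le_card hsub
  rw [Finset.card_range] at h1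
  have h2 := Nat.ceil_lt_add_one h0
  have h3 : ((((Finset.range H).filter fun h => (2 : ℝ) ^ h < y).card : ℕ) : ℝ) ≤
    ⌈Real.logb 2 y⌉₊ := by exact_mod_cast h1
  linarith

/-- Exchange the sums over levels and roots: `α` is charged only at levels with `2 ^ h < 2 (b - a) /
σ α`. This quotient is at least 1 because `σ α ≤ 1 ≤ b - a`. -/
theorem sum_levelCount_le {P : ℤ[X]} (hsep : (P.map (algebraMap ℤ ℚ)).Separable)
    {σ : ℂ → ℝ} (hσ0 : ∀ α ∈ complexRoots P, 0 < σ α ∧ σ α ≤ 1)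
    (hσ : ∀ α ∈ complexRoots P, ∀ β ∈ complexRoots P, β ≠ α → σ α ≤ ‖β - α‖)
    {a b : ℚ} (hab : a + 1 ≤ b) (H : ℕ) :
    ((∑ h ∈ Finset.range H, levelCount P a b h : ℕ) : ℝ) ≤
      2 * ∑ α ∈ complexRoots P, (1 + Real.logb 2 (2 * (b - a)) + Real.logb 2 (1 / σ α)) := by
  have hab' : (1 : ℝ) ≤ b - a := by
    have : (a : ℝ) + 1 ≤ b := by exact_mod_cast hab
    linarith
  have h1 : ∑ h ∈ Finset.range H, levelCount P a b h ≤ 2 * ∑ α ∈ complexRoots P,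
      ((Finset.range H).filter fun h => (2 : ℝ) ^ h < 2 * (b - a) / σ α).card := by
    refine (Finset.sum_le_sum fun h _ => levelCount_le hsep hσ (by linarith) h).trans ?_
    rw [← Finset.mul_sum]
    refine Nat.mul_le_mul_left 2 (le_of_eq ?_)
    simp only [Finset.card_filter]
    rw [Finset.sum_comm]
    refine Finset.sum_congr rfl fun α hα => Finset.sum_congr rfl fun h _ => ?_
    have : (σ α < 2 * (((b : ℝ) - a) / 2 ^ h)) ↔ ((2 : ℝ) ^ h < 2 * (b - a) / σ α) := by
      rw [lt_div_iff₀ (hσ0 α hα).1, ← mul_div_assoc, lt_div_iff₀ (by positivity), mul_comm]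
    simp only [this]
  have h2 : ((∑ h ∈ Finset.range H, levelCount P a b h : ℕ) : ℝ) ≤
      ((2 * ∑ α ∈ complexRoots P,
      ((Finset.range H).filter fun h => (2 : ℝ) ^ h < 2 * (b - a) / σ α).card : ℕ) : ℝ) := by
    exact_mod_cast h1
  refine h2.trans ?_
  push_cast
  gcongr with α hα
  obtain ⟨p0, p1⟩ := hσ0 α hα
  refine (card_filter_pow_lt_le ?_ H).trans (le_of_eq ?_)
  · rw [le_div_iff₀ p0]; linarith
  · rw [div_eq_mul_one_div, Real.logb_mul (by linarith) (by positivity)]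
    ring

/-! ### Termination and cost of the isolation -/

theorem exists_isolate {P : ℤ[X]} (hsep : (P.map (algebraMap ℤ ℚ)).Separable) :
    ∃ L n, Isolate P L n := by
  by_cases hd : P.natDegree = 0
  · exact ⟨[], 0, Isolate.const hd⟩
  obtain ⟨σ, hσ, -⟩ := exists_separation (Nat.pos_of_ne_zero hd) hsep
  have hpos : (0 : ℚ) < 1 + height P := by positivity
  obtain ⟨H, hH⟩ := exists_levelCount_eq_zero hsep (fun α hα => (hσ α hα).1)
    (fun α hα => (hσ α hα).2.2) (a := -(1 + height P : ℚ)) (b := 1 + height P) (by linarith)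
  obtain ⟨L, n, h⟩ := exists_subdivide hH
  exact ⟨L, n, Isolate.run L n hd h⟩

theorem one_le_bitsize (P : ℤ[X]) : 1 ≤ bitsize P := by
  rw [bitsize]
  rcases Nat.eq_zero_or_pos (height P) with h | h
  · simp [h]
  · have := Real.logb_nonneg one_lt_two (show (1 : ℝ) ≤ height P by exact_mod_cast h)
    linarith

theorem Isolate.steps_le {P : ℤ[X]} (hsep : (P.map (algebraMap ℤ ℚ)).Separable)
    {L : List (ℚ × ℚ)} {n : ℕ} (h : Isolate P L n) : (n : ℝ) ≤ 33 * solveBound P := by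
  cases h with
  | const h => simp [solveBound, h]
  | run _ _ hd hrun =>
    have hP : P ≠ 0 := by rintro rfl; simp at hd
    obtain ⟨σ, hσ, hsum⟩ := exists_separation (Nat.pos_of_ne_zero hd) hsep
    have hpos : (1 : ℚ) ≤ 1 + height P := by
      have : (0 : ℚ) ≤ height P := by positivity
      linarith
    obtain ⟨H, hH⟩ := exists_levelCount_eq_zero hsep (fun α hα => (hσ α hα).1)
      (fun α hα => (hσ α hα).2.2) (a := -(1 + height P : ℚ)) (b := 1 + height P) (by linarith)
    have h1 := hrun.steps_le hH
    have h2 := sum_levelCount_le hsep (fun α hα => ⟨(hσ α hα).1, (hσ α hα).2.1⟩)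
      (fun α hα => (hσ α hα).2.2) (a := -(1 + height P : ℚ)) (b := 1 + height P) (by linarith) H
    have h3 : (n : ℝ) ≤ 1 + 2 * ((∑ h ∈ Finset.range H,
        levelCount P (-(1 + height P : ℚ)) (1 + height P) h : ℕ) : ℝ) := by exact_mod_cast h1
    rw [Finset.sum_add_distrib, Finset.sum_const, nsmul_eq_mul] at h2
    push_cast at h2
    have hH1 : (1 : ℝ) ≤ height P := by exact_mod_cast one_le_height hP
    -- The starting interval has length `2 (1 + height P)`, and `4 (1 + height P) ≤ 8 height P`.
    have hlog : 1 + Real.logb 2 (2 * ((1 + height P : ℝ) - -(1 + height P))) ≤ 3 + bitsize P := by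
      have : Real.logb 2 (2 * ((1 + height P : ℝ) - -(1 + height P))) ≤
          Real.logb 2 (2 ^ 3 * height P) :=
        Real.logb_le_logb_of_le one_lt_two (by linarith) (by linarith)
      have e : Real.logb 2 (2 ^ 3 * (height P : ℝ)) = 3 + Real.logb 2 (height P) := by
        rw [Real.logb_mul (by norm_num) (by linarith), Real.logb_pow,
          Real.logb_self_eq_one one_lt_two]
        norm_num
      rw [bitsize]
      linarith
    have hd1 : (1 : ℝ) ≤ P.natDegree := by exact_mod_cast Nat.pos_of_ne_zero hd
    have hb := one_le_bitsize P
    have hc : ((complexRoots P).card : ℝ) * (1 + Real.logb 2 (2 * ((1 + height P : ℝ) -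
        -(1 + height P)))) ≤ P.natDegree * (3 + bitsize P) := by
      calc _ ≤ ((complexRoots P).card : ℝ) * (3 + bitsize P) := by gcongr
        _ ≤ _ := by
          have : ((complexRoots P).card : ℝ) ≤ P.natDegree := by
            exact_mod_cast card_complexRoots_le P
          gcongr
    have hl : 0 ≤ Real.logb 2 (P.natDegree : ℝ) := Real.logb_nonneg one_lt_two hd1
    have hdb : 1 ≤ (P.natDegree : ℝ) * bitsize P := by nlinarith
    have hdd : (P.natDegree : ℝ) ≤ P.natDegree * bitsize P := by nlinarith
    have hdl : 0 ≤ (P.natDegree : ℝ) * Real.logb 2 P.natDegree := by positivity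
    -- With `d` the degree, the estimates add up to `n ≤ 1 + 4 d (5 + 4 lg d + 3 τ)`. Since `1 ≤ d
    -- τ` and `d ≤ d τ`, the coefficient of `d τ` becomes `1 + 20 + 12 = 33`, and that of `d lg d`
    -- is 16.
    rw [solveBound]
    push_cast at h3
    linarith

/-! ### Lower bounds for nonzero values at algebraic points -/

theorem aevalAeval_eq_sum {R A : Type*} [CommRing R] [CommRing A] [Algebra R A] (x y : A)
    (F : R[X][Y]) : aevalAeval x y F = F.sum fun j q => aeval x q * y ^ j := by
  have h : aevalAeval x y F = F.eval₂ (aeval x : R[X] →ₐ[R] A).toRingHom y := by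
    induction F using Polynomial.induction_on' with
    | add p q hp hq => rw [map_add, eval₂_add, hp, hq]
    | monomial n q =>
      rw [eval₂_monomial, ← C_mul_X_pow_eq_monomial, map_mul, map_pow, aevalAeval_C, aevalAeval_Y]
      rfl
  rw [h, eval₂_eq_sum]
  rfl

theorem norm_aeval_le {P : ℤ[X]} {n : ℕ} (hn : P.natDegree ≤ n) (x : ℂ) :
    ‖aeval x P‖ ≤ norm1 P * max 1 ‖x‖ ^ n := by
  rw [← eval_map_algebraMap, ← complexNorm1_map]
  exact norm_eval_le (natDegree_map_le.trans hn) x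

theorem norm_aevalAeval_le {F : ℤ[X][Y]} {m n : ℕ} (hm : ∀ j, (F.coeff j).natDegree ≤ m)
    (hn : F.natDegree ≤ n) (x y : ℂ) :
    ‖aevalAeval x y F‖ ≤ biNorm1 F * max 1 ‖x‖ ^ m * max 1 ‖y‖ ^ n := by
  rw [aevalAeval_eq_sum, Polynomial.sum, biNorm1]
  push_cast
  rw [Finset.sum_mul, Finset.sum_mul]
  refine norm_sum_le_of_le _ fun j hj => ?_
  rw [norm_mul, norm_pow]
  gcongr
  · exact norm_aeval_le (hm j) x
  · calc ‖y‖ ^ j ≤ max 1 ‖y‖ ^ j := by gcongr; exact le_max_right _ _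
      _ ≤ max 1 ‖y‖ ^ n := pow_le_pow_right₀ (le_max_left _ _)
        ((le_natDegree_of_mem_supp j hj).trans hn)

theorem exists_fin_enumeration (s : Multiset ℂ) {n : ℕ} (hn : s.card = n) :
    ∃ a : Fin n → ℂ, s = Finset.univ.val.map a := by
  obtain ⟨l, rfl⟩ : ∃ l : List ℂ, (l : Multiset ℂ) = s := ⟨s.toList, s.coe_toList⟩
  rw [Multiset.coe_card] at hn
  subst hn
  exact ⟨l.get, by rw [Fin.univ_val_map, List.ofFn_get]⟩

/-- The other argument may have coefficients in a polynomial ring over `ℂ`: there `T` still splits,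
with its complex roots as constants. -/
theorem resultant_map_eq_prod {B : Type*} [CommRing B] [IsDomain B] {ι : ℂ →+* B}
    {f : ℤ →+* B} (hf : Function.Injective f)
    {T : ℤ[X]} {n : ℕ} {b : Fin T.natDegree → ℂ}
    (hb : (T.map (algebraMap ℤ ℂ)).roots = Finset.univ.val.map b) (g : B[X])
    (hg : g.natDegree ≤ n) :
    resultant (T.map f) g T.natDegree n =
      f T.leadingCoeff ^ n * ∏ j, g.eval (ι (b j)) := by
  have hι : Function.Injective ι := ι.injective
  have hmap : T.map f = (T.map (algebraMap ℤ ℂ)).map ι := by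
    rw [Polynomial.map_map]; congr 1; exact RingHom.ext_int _ _
  have hs : (T.map (algebraMap ℤ ℂ)).Splits := IsAlgClosed.splits _
  have hroots : (T.map f).roots = (Finset.univ.val.map b).map ι := by
    rw [hmap, hs.roots_map_of_injective hι, hb]
  have h1 := resultant_eq_prod_eval (T.map f) g n hg (hmap ▸ hs.map ι)
  rw [natDegree_map_eq_of_injective hf, leadingCoeff_map_of_injective hf, hroots] at h1
  rw [h1, Multiset.map_map, Multiset.map_map]
  rfl

/-- The polynomial `∏ (z - F(α_i, β_j))` has integer coefficients after multiplication with powers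
of the leading coefficients of the polynomials that define the `α_i` and `β_j`. -/
theorem exists_int_polynomial_of_values {t T : ℤ[X]} {F : ℤ[X][Y]} {m n : ℕ}
    (hm : ∀ j, (F.coeff j).natDegree ≤ m) (hn : F.natDegree ≤ n)
    {a : Fin t.natDegree → ℂ} (ha : (t.map (algebraMap ℤ ℂ)).roots = Finset.univ.val.map a)
    {b : Fin T.natDegree → ℂ} (hb : (T.map (algebraMap ℤ ℂ)).roots = Finset.univ.val.map b) :
    ∃ R : ℤ[X], R.map (algebraMap ℤ ℂ) =
      C ((t.leadingCoeff : ℂ) ^ (m * T.natDegree) * ((T.leadingCoeff : ℂ) ^ n) ^ t.natDegree) *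
        ∏ i, ∏ j, (X - C (aevalAeval (a i) (b j) F)) := by
  set φ : ℤ[X] →+* ℂ[X] := mapRingHom (algebraMap ℤ ℂ) with hφ
  -- This is `z - F(x, y)` with `z` innermost and `y` outermost. The resultant with `T` eliminates
  -- `y`, the one with `t` then eliminates `x`.
  set H : ℤ[X][X][Y] := C (C X) - F.map (mapRingHom C) with hH
  set R₁ : ℤ[X][X] := resultant (T.map ((C : ℤ[X] →+* ℤ[X][X]).comp C)) H T.natDegree n with hR₁
  refine ⟨resultant (t.map C) R₁ t.natDegree (m * T.natDegree), ?_⟩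
  set H' : ℂ[X][X][Y] := H.map (mapRingHom φ) with hH'
  have hH'n : H'.natDegree ≤ n := by
    refine natDegree_map_le.trans ((natDegree_sub_le _ _).trans (max_le (by simp) ?_))
    exact natDegree_map_le.trans hn
  have hval : ∀ j, H'.eval (C (C (b j))) =
      C X - (F.map (mapRingHom ((C : ℂ →+* ℂ[X]).comp (algebraMap ℤ ℂ)))).eval (C (C (b j))) := by
    intro j
    rw [hH', hH, Polynomial.map_sub, eval_sub, Polynomial.map_map]
    congr 1
    · simp [hφ]
    · congr 2
      ext <;> simp [hφ]
  have hval2 : ∀ i j, (H'.eval (C (C (b j)))).eval (C (a i)) =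
      X - C (aevalAeval (a i) (b j) F) := by
    intro i j
    rw [hval, eval_sub, eval_C]
    congr 1
    have : ((evalRingHom (C (a i))).comp ((evalRingHom (C (C (b j)))).comp
        (mapRingHom (mapRingHom ((C : ℂ →+* ℂ[X]).comp (algebraMap ℤ ℂ)))))) =
        (C : ℂ →+* ℂ[X]).comp (aevalAeval (a i) (b j) : ℤ[X][Y] →ₐ[ℤ] ℂ).toRingHom := by
      ext <;> simp
    exact DFunLike.congr_fun this F
  have hdegval : ∀ j, (H'.eval (C (C (b j)))).natDegree ≤ m := by
    intro j
    rw [hval]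
    refine (natDegree_sub_le _ _).trans (max_le (by simp) ?_)
    rw [eval_eq_sum_range]
    refine natDegree_sum_le_of_forall_le _ _ fun k _ => ?_
    rw [← C_pow]
    refine (natDegree_mul_C_le _ _).trans ?_
    rw [coeff_map]
    exact natDegree_map_le.trans (hm k)
  have hR₁' : R₁.map φ = C (C ((T.leadingCoeff : ℂ) ^ n)) * ∏ j, H'.eval (C (C (b j))) := by
    have h1 := resultant_map_eq_prod (B := ℂ[X][X])
      (ι := (C : ℂ[X] →+* ℂ[X][X]).comp C)
      (f := ((mapRingHom φ).comp ((C : ℤ[X] →+* ℤ[X][X]).comp C)))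
      (RingHom.injective_int _) hb H' hH'n
    rw [← Polynomial.map_map, hH', resultant_map_map] at h1
    rw [← coe_mapRingHom, hR₁, h1, hH']
    simp [hφ]
  -- Each of the `deg T` factors has degree at most `m` in `x`; this formal degree is the exponent
  -- of the leading coefficient of `t`.
  have hR₁n : (R₁.map φ).natDegree ≤ m * T.natDegree := by
    rw [hR₁']
    refine (natDegree_C_mul_le _ _).trans ((natDegree_prod_le _ _).trans ?_)
    refine (Finset.sum_le_sum fun j _ => hdegval j).trans (le_of_eq ?_)
    simp [mul_comm]
  have h2 := resultant_map_eq_prod (B := ℂ[X]) (ι := C) (f := φ.comp C)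
    (RingHom.injective_int _) ha (R₁.map φ) hR₁n
  rw [← Polynomial.map_map, resultant_map_map] at h2
  rw [← coe_mapRingHom, ← hφ, h2, hR₁']
  simp only [eval_mul, eval_C, eval_prod, hval2, Finset.prod_mul_distrib, Finset.prod_const,
    Finset.card_univ, Fintype.card_fin]
  simp [hφ, mul_assoc]

theorem trailingCoeff_prod {ι : Type*} (s : Finset ι) (f : ι → ℂ[X]) :
    (∏ i ∈ s, f i).trailingCoeff = ∏ i ∈ s, (f i).trailingCoeff := by
  classical
  induction s using Finset.induction_on with
  | empty => simp [trailingCoeff]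
  | insert i s hi ih => rw [Finset.prod_insert hi, Finset.prod_insert hi, trailingCoeff_mul, ih]

/-- Zero values contribute 1, so a trailing coefficient, unlike a constant term, stays nonzero when
some conjugate values vanish. -/
theorem trailingCoeff_X_sub_C (v : ℂ) :
    (X - C v : ℂ[X]).trailingCoeff = if v = 0 then 1 else -v := by
  split_ifs with h
  · simp [h, trailingCoeff]
  · rw [trailingCoeff_eq_coeff_zero] <;> simp [h]

/-- A Liouville inequality for the values of an integer polynomial at algebraic numbers. -/
theorem one_le_norm_aevalAeval_mul {t T : ℤ[X]} (ht : t ≠ 0) (hT : T ≠ 0) {F : ℤ[X][Y]} {m n : ℕ}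
    (hm : ∀ j, (F.coeff j).natDegree ≤ m) (hn : F.natDegree ≤ n) {N M : ℝ} (hN : 1 ≤ N)
    (hFN : (biNorm1 F : ℝ) ≤ N) (htM : (norm1 t : ℝ) ≤ M) (hTM : (norm1 T : ℝ) ≤ M) {α β : ℂ}
    (hα : aeval α t = 0) (hβ : aeval β T = 0) (h : aevalAeval α β F ≠ 0) :
    1 ≤ ‖aevalAeval α β F‖ * N ^ (t.natDegree * T.natDegree - 1) *
      M ^ (m * T.natDegree + n * t.natDegree) := by
  have hinj : Function.Injective (algebraMap ℤ ℂ) := (algebraMap ℤ ℂ).injective_int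
  have hcard : ∀ P : ℤ[X], (P.map (algebraMap ℤ ℂ)).roots.card = P.natDegree := fun P => by
    rw [splits_iff_card_roots.mp (IsAlgClosed.splits _), natDegree_map_eq_of_injective hinj]
  obtain ⟨a, ha⟩ := exists_fin_enumeration _ (hcard t)
  obtain ⟨b, hb⟩ := exists_fin_enumeration _ (hcard T)
  have hmem : ∀ {P : ℤ[X]} (_ : P ≠ 0) {c : Fin P.natDegree → ℂ}
      (_ : (P.map (algebraMap ℤ ℂ)).roots = Finset.univ.val.map c) {z : ℂ} (_ : aeval z P = 0),
      ∃ i, c i = z := by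
    intro P hP c hc z hz
    have : z ∈ (P.map (algebraMap ℤ ℂ)).roots := by
      rw [mem_roots ((Polynomial.map_ne_zero_iff hinj).mpr hP), IsRoot, eval_map_algebraMap, hz]
    rw [hc] at this
    simpa using this
  obtain ⟨i₀, rfl⟩ := hmem ht ha hα
  obtain ⟨j₀, rfl⟩ := hmem hT hb hβ
  obtain ⟨R, hR⟩ := exists_int_polynomial_of_values hm hn ha hb
  have hd : 0 < t.natDegree * T.natDegree := Nat.mul_pos (Fin.pos i₀) (Fin.pos j₀)
  set A : ℝ := |(t.leadingCoeff : ℝ)| with hA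
  set B : ℝ := |(T.leadingCoeff : ℝ)| with hB
  set w : Fin t.natDegree × Fin T.natDegree → ℝ :=
    fun k => ‖(X - C (aevalAeval (a k.1) (b k.2) F) : ℂ[X]).trailingCoeff‖ with hw
  set U : Fin t.natDegree × Fin T.natDegree → ℝ := fun k => N * max 1 ‖a k.1‖ ^ m * max 1 ‖b k.2‖ ^ n with hU
  have hone : ∀ z : ℂ, (1 : ℝ) ≤ max 1 ‖z‖ := fun z => le_max_left _ _
  have hUN : ∀ k, N ≤ U k := fun k => by
    have h1 := one_le_pow₀ (n := m) (hone (a k.1))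
    have h2 := one_le_pow₀ (n := n) (hone (b k.2))
    calc N = N * 1 * 1 := by ring
      _ ≤ N * max 1 ‖a k.1‖ ^ m * max 1 ‖b k.2‖ ^ n := by gcongr
  have hwU : ∀ k, w k ≤ U k := fun k => by
    rw [hw]
    simp only
    rw [trailingCoeff_X_sub_C]
    split_ifs with h0
    · rw [norm_one]; exact hN.trans (hUN k)
    · rw [norm_neg]
      refine (norm_aevalAeval_le hm hn _ _).trans ?_
      change _ ≤ N * max 1 ‖a k.1‖ ^ m * max 1 ‖b k.2‖ ^ n
      gcongr
  -- The trailing coefficient of a nonzero integer polynomial is a nonzero integer.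
  have hone_le : 1 ≤ A ^ (m * T.natDegree) * (B ^ n) ^ t.natDegree * ∏ k, w k := by
    have h1 := congrArg (fun p : ℂ[X] => ‖p.trailingCoeff‖) hR
    simp only [trailingCoeff_mul, trailingCoeff_prod, norm_mul, norm_prod] at h1
    rw [← Fintype.prod_prod_type' (f := fun i j =>
      ‖(X - C (aevalAeval (a i) (b j) F) : ℂ[X]).trailingCoeff‖)] at h1
    have h2 : ‖(C ((t.leadingCoeff : ℂ) ^ (m * T.natDegree) * ((T.leadingCoeff : ℂ) ^ n) ^ t.natDegree) :
        ℂ[X]).trailingCoeff‖ = A ^ (m * T.natDegree) * (B ^ n) ^ t.natDegree := by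
      rw [trailingCoeff, natTrailingDegree_C, coeff_C_zero, norm_mul, norm_pow, norm_pow, norm_pow,
        Complex.norm_intCast, Complex.norm_intCast]
    rw [h2] at h1
    rw [← h1]
    have hR0 : (R.map (algebraMap ℤ ℂ)) ≠ 0 := by
      rw [hR]
      refine mul_ne_zero ?_ (Finset.prod_ne_zero_iff.mpr fun i _ =>
        Finset.prod_ne_zero_iff.mpr fun j _ => X_sub_C_ne_zero _)
      rw [Ne, C_eq_zero]
      have := leadingCoeff_ne_zero.mpr ht
      have := leadingCoeff_ne_zero.mpr hT
      positivity
    have h3 : (R.map (algebraMap ℤ ℂ)).trailingCoeff ≠ 0 := mt trailingCoeff_eq_zero.mp hR0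
    rw [trailingCoeff, coeff_map, algebraMap_int_eq, eq_intCast] at h3 ⊢
    rw [Complex.norm_intCast]
    exact_mod_cast Int.one_le_abs (by exact_mod_cast h3)
  have hw0 : w (i₀, j₀) = ‖aevalAeval (a i₀) (b j₀) F‖ := by
    rw [hw]
    simp only
    rw [trailingCoeff_X_sub_C, if_neg h, norm_neg]
  have hwn : ∀ k, 0 ≤ w k := fun k => norm_nonneg _
  have hN0 : 0 < N := by linarith
  have hU0 : ∀ k, 0 < U k := fun k => hN0.trans_le (hUN k)
  -- All factors but the one of interest are replaced by their upper bounds. The spare bound `U (i₀,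
  -- j₀) ≥ N` pays for the extra `N`, which lowers the final exponent of `N` to `s - 1`.
  have hprod : (∏ k, w k) * N ≤ w (i₀, j₀) * ∏ k, U k := by
    rw [← Finset.mul_prod_erase _ _ (Finset.mem_univ (i₀, j₀)),
      ← Finset.mul_prod_erase _ U (Finset.mem_univ (i₀, j₀))]
    calc w (i₀, j₀) * (∏ k ∈ Finset.univ.erase (i₀, j₀), w k) * N
        ≤ w (i₀, j₀) * (∏ k ∈ Finset.univ.erase (i₀, j₀), U k) * U (i₀, j₀) := by
          have := hwn (i₀, j₀)
          have := Finset.prod_nonneg (s := Finset.univ.erase (i₀, j₀)) fun k _ => (hU0 k).le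
          gcongr with k
          · exact hwU k
          · exact hUN _
      _ = _ := by ring
  have hMt : A * ∏ i, max 1 ‖a i‖ ≤ M := by
    have := leadingCoeff_mul_prod_roots_le t
    rw [ha, Multiset.map_map] at this
    exact this.trans htM
  have hMT : B * ∏ j, max 1 ‖b j‖ ≤ M := by
    have := leadingCoeff_mul_prod_roots_le T
    rw [hb, Multiset.map_map] at this
    exact this.trans hTM
  have hprodU : ∏ k, U k = N ^ (t.natDegree * T.natDegree) * (∏ i, max 1 ‖a i‖) ^ (m * T.natDegree) *
      (∏ j, max 1 ‖b j‖) ^ (n * t.natDegree) := by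
    rw [hU, Finset.prod_mul_distrib, Finset.prod_mul_distrib, Finset.prod_const,
      Fintype.prod_prod_type, Fintype.prod_prod_type]
    simp only [Finset.prod_const, Finset.card_univ, Fintype.card_prod, Fintype.card_fin,
      Finset.prod_pow, ← pow_mul]
  have hA0 : 0 ≤ A := abs_nonneg _
  have hB0 : 0 ≤ B := abs_nonneg _
  set pa := ∏ i, max 1 ‖a i‖ with hpa
  set pb := ∏ j, max 1 ‖b j‖ with hpb
  have hpa0 : 0 ≤ pa := Finset.prod_nonneg fun i _ => zero_le_one.trans (hone _)
  have hpb0 : 0 ≤ pb := Finset.prod_nonneg fun i _ => zero_le_one.trans (hone _)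
  refine le_of_mul_le_mul_right ?_ hN0
  calc 1 * N ≤ A ^ (m * T.natDegree) * (B ^ n) ^ t.natDegree * (∏ k, w k) * N := by gcongr
    _ = A ^ (m * T.natDegree) * (B ^ n) ^ t.natDegree * ((∏ k, w k) * N) := by ring
    _ ≤ A ^ (m * T.natDegree) * (B ^ n) ^ t.natDegree * (w (i₀, j₀) * ∏ k, U k) := by gcongr
    _ = w (i₀, j₀) * N ^ (t.natDegree * T.natDegree) * ((A * pa) ^ (m * T.natDegree) * (B * pb) ^ (n * t.natDegree)) := by
      rw [hprodU, ← pow_mul, mul_pow, mul_pow]; ring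
    _ ≤ w (i₀, j₀) * N ^ (t.natDegree * T.natDegree) * (M ^ (m * T.natDegree) * M ^ (n * t.natDegree)) := by
      have := hwn (i₀, j₀)
      have : 0 ≤ M := (Nat.cast_nonneg _).trans htM
      gcongr
    _ = _ := by
      rw [hw0, ← pow_add]
      obtain ⟨s, hs⟩ := Nat.exists_eq_succ_of_ne_zero hd.ne'
      rw [hs, Nat.succ_eq_add_one, Nat.add_sub_cancel, pow_succ]
      ring

/-! ### Projections of the solutions -/

/-- The set of complex solutions of `F = G = 0`. -/
def complexSolutions (F G : ℤ[X][Y]) : Set (ℂ × ℂ) :=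
  {p | aevalAeval p.1 p.2 F = 0 ∧ aevalAeval p.1 p.2 G = 0}

theorem complexSolutions_swap (F G : ℤ[X][Y]) :
    complexSolutions (Bivariate.swap F) (Bivariate.swap G) =
      Prod.swap '' complexSolutions F G := by
  ext ⟨x, y⟩
  rw [Set.image_swap_eq_preimage_swap]
  change (aevalAeval x y (Bivariate.swap F) = 0 ∧ aevalAeval x y (Bivariate.swap G) = 0) ↔
    (aevalAeval y x F = 0 ∧ aevalAeval y x G = 0)
  rw [Bivariate.aevalAeval_swap, Bivariate.aevalAeval_swap]

theorem aevalAeval_eq_eval_map (F : ℤ[X][Y]) (x y : ℂ) :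
    aevalAeval x y F = (F.map (aeval x : ℤ[X] →ₐ[ℤ] ℂ).toRingHom).eval y := by
  rw [aevalAeval_eq_sum, eval_map, eval₂_eq_sum]
  rfl

/-- If the resultant vanished, then for all `x` outside the finitely many roots of the leading
coefficients the specializations would keep their degrees and have a common root `y`, giving
infinitely many solutions. -/
theorem resultant_ne_zero_of_finite {F G : ℤ[X][Y]} (h : (complexSolutions F G).Finite) :
    resultant F G ≠ 0 := by
  intro h0
  have key : ∀ H : ℤ[X][Y], ∃ Q : ℤ[X], Q ≠ 0 ∧ ∀ x : ℂ, aeval x Q ≠ 0 →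
      (H.map (aeval x : ℤ[X] →ₐ[ℤ] ℂ).toRingHom).natDegree = H.natDegree := by
    intro H
    by_cases hH : H = 0
    · exact ⟨1, one_ne_zero, fun x _ => by simp [hH]⟩
    · exact ⟨H.leadingCoeff, leadingCoeff_ne_zero.mpr hH, fun x hx =>
        natDegree_map_of_leadingCoeff_ne_zero _ hx⟩
  obtain ⟨Q₁, hQ₁, h₁⟩ := key F
  obtain ⟨Q₂, hQ₂, h₂⟩ := key G
  have hsub : ((complexRoots (Q₁ * Q₂) : Set ℂ))ᶜ ⊆ Prod.fst '' complexSolutions F G := by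
    intro x hx
    rw [Set.mem_compl_iff, Finset.mem_coe, mem_complexRoots (mul_ne_zero hQ₁ hQ₂), map_mul,
      mul_eq_zero, not_or] at hx
    set φ : ℤ[X] →+* ℂ := (aeval x : ℤ[X] →ₐ[ℤ] ℂ).toRingHom with hφ
    have hres : resultant (F.map φ) (G.map φ) = 0 := by
      rw [h₁ x hx.1, h₂ x hx.2, resultant_map_map, h0, map_zero]
    have hnc := (resultant_eq_zero_iff.mp hres).2
    rw [isCoprime_iff_aeval_ne_zero_of_isAlgClosed ℂ ℂ] at hnc
    push Not at hnc
    obtain ⟨y, hy₁, hy₂⟩ := hnc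
    refine ⟨(x, y), ⟨?_, ?_⟩, rfl⟩
    · rw [aevalAeval_eq_eval_map]; rwa [coe_aeval_eq_eval] at hy₁
    · rw [aevalAeval_eq_eval_map]; rwa [coe_aeval_eq_eval] at hy₂
  exact ((Finset.finite_toSet _).infinite_compl) ((h.image _).subset hsub)

/-- The resultant is a combination of `F` and `G` unless both are free of `y`; in that case one
solution brings a whole vertical line, against finiteness. -/
theorem aeval_resultant_eq_zero {F G : ℤ[X][Y]} (h : (complexSolutions F G).Finite) {x y : ℂ}
    (hF : aevalAeval x y F = 0) (hG : aevalAeval x y G = 0) : aeval x (resultant F G) = 0 := by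
  by_cases hd : F.natDegree = 0 ∧ G.natDegree = 0
  · exfalso
    rw [eq_C_of_natDegree_eq_zero hd.1, aevalAeval_C] at hF
    rw [eq_C_of_natDegree_eq_zero hd.2, aevalAeval_C] at hG
    refine Set.infinite_of_injective_forall_mem (f := fun z : ℂ => (x, z))
      (fun z w e => (Prod.mk.inj e).2) (fun z => ?_) h
    refine ⟨?_, ?_⟩
    · rw [eq_C_of_natDegree_eq_zero hd.1, aevalAeval_C, hF]
    · rw [eq_C_of_natDegree_eq_zero hd.2, aevalAeval_C, hG]
  · obtain ⟨p, q, -, -, e⟩ := exists_mul_add_mul_eq_C_resultant F G le_rfl le_rfl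
      (by rwa [← not_and_or])
    have := congrArg (aevalAeval x y) e
    rwa [map_add, map_mul, map_mul, hF, hG, zero_mul, zero_mul, zero_add, aevalAeval_C,
      eq_comm] at this

/-- Some irreducible factor of the resultant vanishes at `x`, and the given solution itself shows
that this factor is not extraneous. -/
theorem aeval_noExtrRes_eq_zero {F G : ℤ[X][Y]} (h : (complexSolutions F G).Finite) {x y : ℂ}
    (hF : aevalAeval x y F = 0) (hG : aevalAeval x y G = 0) : aeval x (noExtrRes F G) = 0 := by
  classical
  have hres := aeval_resultant_eq_zero h hF hG
  rw [noExtrRes]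
  split_ifs with hirr
  · exact hres
  · have hassoc := UniqueFactorizationMonoid.prod_normalizedFactors (resultant_ne_zero_of_finite h)
    have h0 : aeval x (UniqueFactorizationMonoid.normalizedFactors (resultant F G)).prod = 0 := by
      obtain ⟨q, hq⟩ := hassoc.symm.dvd
      rw [hq, map_mul, hres, zero_mul]
    rw [map_multiset_prod, Multiset.prod_eq_zero_iff, Multiset.mem_map] at h0
    obtain ⟨p, hp, hp0⟩ := h0
    rw [map_prod]
    refine Finset.prod_eq_zero (i := p) ?_ hp0
    rw [Finset.mem_filter, Multiset.mem_toFinset]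
    exact ⟨hp, not_not.mpr ⟨x, y, hF, hG, hp0⟩⟩

/-- By Gauss's lemma distinct normalized primitive irreducible factors remain irreducible and
non-associated over `ℚ`, hence coprime, and characteristic 0 makes each separable. If the resultant
is 0, it has no normalized factors and the product is 1. -/
theorem separable_noExtrRes (F G : ℤ[X][Y]) :
    ((noExtrRes F G).map (algebraMap ℤ ℚ)).Separable := by
  classical
  rw [noExtrRes]
  split_ifs with hirr
  · exact hirr.separable
  · have key : ∀ p ∈ (UniqueFactorizationMonoid.normalizedFactors
        (resultant F G)).toFinset.filter (fun p => ¬ Extraneous F G p),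
        Irreducible p ∧ normalize p = p ∧ p.IsPrimitive := by
      intro p hp
      rw [Finset.mem_filter, Multiset.mem_toFinset] at hp
      have hi := UniqueFactorizationMonoid.irreducible_of_normalized_factor p hp.1
      refine ⟨hi, UniqueFactorizationMonoid.normalize_normalized_factor p hp.1,
        hi.isPrimitive fun hd => ?_⟩
      -- A retained factor vanishes at some point, so it is not a nonzero constant.
      obtain ⟨x, y, -, -, h0⟩ := not_not.mp hp.2
      rw [eq_C_of_natDegree_eq_zero hd, aeval_C] at h0
      have h1 : p.coeff 0 = 0 := by simpa using h0
      exact hi.ne_zero (by rw [eq_C_of_natDegree_eq_zero hd, h1, C_0])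
    rw [Polynomial.map_prod]
    refine separable_prod' ?_ ?_
    · intro p hp q hq hne
      obtain ⟨hpi, hpn, hpp⟩ := key p hp
      obtain ⟨hqi, hqn, hqp⟩ := key q hq
      have hpi' := (IsPrimitive.Int.irreducible_iff_irreducible_map_cast hpp).mp hpi
      have hqi' := (IsPrimitive.Int.irreducible_iff_irreducible_map_cast hqp).mp hqi
      refine (hpi'.coprime_iff_not_dvd).mpr fun hdvd => hne ?_
      have hd := (IsPrimitive.Int.dvd_iff_map_cast_dvd_map_cast _ _ hpp).mpr hdvd
      have := hpi.associated_of_dvd hqi hd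
      rw [← hpn, ← hqn]
      exact normalize_eq_normalize_iff_associated.mpr this
    · intro p hp
      obtain ⟨hpi, -, hpp⟩ := key p hp
      exact ((IsPrimitive.Int.irreducible_iff_irreducible_map_cast hpp).mp hpi).separable

theorem noExtrRes_ne_zero (F G : ℤ[X][Y]) : noExtrRes F G ≠ 0 := fun h =>
  (separable_noExtrRes F G).ne_zero (by rw [h, Polynomial.map_zero])

theorem coeff_coeff_swap (F : ℤ[X][Y]) (i j : ℕ) :
    ((Bivariate.swap F).coeff i).coeff j = (F.coeff j).coeff i := by
  induction F using Polynomial.induction_on' with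
  | add p q hp hq => simp [hp, hq]
  | monomial n q =>
    induction q using Polynomial.induction_on' with
    | add p q hp hq => simp only [map_add, coeff_add, hp, hq]
    | monomial m r =>
      rw [Bivariate.swap_monomial_monomial]
      simp only [coeff_monomial]
      split_ifs <;> simp_all [coeff_monomial]

theorem natDegree_coeff_le_natDegree_swap (F : ℤ[X][Y]) (j : ℕ) :
    (F.coeff j).natDegree ≤ (Bivariate.swap F).natDegree := by
  refine natDegree_le_iff_coeff_eq_zero.mpr fun i hi => ?_
  rw [← coeff_coeff_swap, coeff_eq_zero_of_natDegree_lt hi, coeff_zero]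

/-! ### Clearing denominators -/

theorem coe_num_mul_of_den_dvd {q : ℚ} {D : ℕ} (h : q.den ∣ D) :
    (((q * (D : ℚ)).num : ℤ) : ℚ) = q * D := by
  obtain ⟨k, rfl⟩ := h
  have : q * ((q.den * k : ℕ) : ℚ) = ((q.num * k : ℤ) : ℚ) := by
    push_cast
    rw [← mul_assoc, Rat.mul_den_eq_num]
  rw [this, Rat.num_intCast]

theorem commonDen_ne_zero (f : ℚ[X][Y]) : commonDen f ≠ 0 := by
  rw [commonDen, Ne, Finset.lcm_eq_zero_iff]
  rintro ⟨j, -, hj⟩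
  simp only [Finset.lcm_eq_zero_iff] at hj
  obtain ⟨i, -, hi⟩ := hj
  exact Rat.den_ne_zero _ hi

theorem aevalAeval_clearDen {A : Type*} [Field A] [Algebra ℚ A] (f : ℚ[X][Y]) (x y : A) :
    aevalAeval x y (clearDen f) = (commonDen f : A) * aevalAeval x y f := by
  have hmono : ∀ (j : ℕ) (q : ℤ[X]), aevalAeval x y (monomial j q) = aeval x q * y ^ j := by
    intro j q
    rw [← C_mul_X_pow_eq_monomial, map_mul, map_pow, aevalAeval_C, aevalAeval_Y]
  rw [clearDen, map_sum, aevalAeval_eq_sum, Polynomial.sum, Finset.mul_sum]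
  refine Finset.sum_congr rfl fun j hj => ?_
  rw [hmono, ← mul_assoc]
  congr 1
  rw [map_sum, aeval_eq_sum_range, ← Polynomial.sum_over_range' (f.coeff j)
    (f := fun i c => c • x ^ i) (fun i => by simp) _ (Nat.lt_succ_self _), Polynomial.sum,
    Finset.mul_sum]
  refine Finset.sum_congr rfl fun i hi => ?_
  have hdvd : ((f.coeff j).coeff i).den ∣ commonDen f :=
    (Finset.dvd_lcm (f := fun i => ((f.coeff j).coeff i).den) hi).trans
      (Finset.dvd_lcm (f := fun j => (f.coeff j).support.lcm fun i =>
        ((f.coeff j).coeff i).den) hj)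
  have h := congrArg (algebraMap ℚ A) (coe_num_mul_of_den_dvd hdvd)
  rw [map_intCast, map_mul, map_natCast] at h
  rw [aeval_monomial, algebraMap_int_eq, eq_intCast, h, Algebra.smul_def]
  ring

theorem aevalAeval_clearDen_eq_zero_iff {A : Type*} [Field A] [Algebra ℚ A] [CharZero A]
    (f : ℚ[X][Y]) (x y : A) :
    aevalAeval x y (clearDen f) = 0 ↔ aevalAeval x y f = 0 := by
  rw [aevalAeval_clearDen, mul_eq_zero, Nat.cast_eq_zero]
  simp only [commonDen_ne_zero, false_or]

theorem aevalAeval_ofReal (F : ℤ[X][Y]) (x y : ℝ) :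
    aevalAeval (x : ℂ) (y : ℂ) F = ((aevalAeval x y F : ℝ) : ℂ) := by
  rw [aevalAeval_eq_sum, aevalAeval_eq_sum, Polynomial.sum, Polynomial.sum, Complex.ofReal_sum]
  refine Finset.sum_congr rfl fun j _ => ?_
  rw [Complex.ofReal_mul, Complex.ofReal_pow]
  congr 1
  exact aeval_algebraMap_apply ℂ x (F.coeff j)

theorem aeval_ofReal_eq_zero_iff (P : ℤ[X]) (x : ℝ) :
    aeval (x : ℂ) P = 0 ↔ aeval x P = 0 := by
  rw [show (x : ℂ) = algebraMap ℝ ℂ x from rfl, aeval_algebraMap_apply]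
  simp

/-! ### Matching -/

theorem matchRow_eq {A B : Type} (test : A → B → Bool) (a : A) (bs : List B) :
    matchRow test a bs = ((bs.map (Prod.mk a)).filter fun p => test p.1 p.2, bs.length) := by
  induction bs with
  | nil => rfl
  | cons b bs ih => simp [matchRow, ih, List.filter_cons]

theorem matchAll_eq {A B : Type} (test : A → B → Bool) (as : List A) (bs : List B) :
    matchAll test as bs =
      ((as ×ˢ bs).filter fun p => test p.1 p.2, as.length * bs.length) := by
  induction as with
  | nil => simp [matchAll]
  | cons a as ih =>
    simp [matchAll, ih, matchRow_eq, List.product_cons, List.filter_append]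
    ring

theorem IsIsolation.isoRoot_spec {P : ℤ[X]} {L : List (ℚ × ℚ)} (h : IsIsolation P L) {I : ℚ × ℚ}
    (hI : I ∈ L) : InIv I (isoRoot P I) ∧ aeval (isoRoot P I) P = 0 :=
  Classical.epsilon_spec (h.2.1 I hI).exists

theorem IsIsolation.eq_isoRoot {P : ℤ[X]} {L : List (ℚ × ℚ)} (h : IsIsolation P L) {I : ℚ × ℚ}
    (hI : I ∈ L) {x : ℝ} (hx : InIv I x) (hx0 : aeval x P = 0) : x = isoRoot P I :=
  (h.2.1 I hI).unique ⟨hx, hx0⟩ (h.isoRoot_spec hI)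

theorem IsIsolation.length_le {P : ℤ[X]} (hP : P ≠ 0) {L : List (ℚ × ℚ)} (h : IsIsolation P L) :
    L.length ≤ (P.rootSet ℝ).ncard := by
  classical
  rw [← List.toFinset_card_of_nodup h.1, ← Set.ncard_coe_finset]
  refine Set.ncard_le_ncard_of_injOn (isoRoot P) ?_ ?_ (rootSet_finite P ℝ)
  · intro I hI
    rw [mem_rootSet]
    exact ⟨hP, (h.isoRoot_spec (List.mem_toFinset.mp hI)).2⟩
  · intro I hI J hJ e
    have hI' := List.mem_toFinset.mp hI
    have hJ' := List.mem_toFinset.mp hJ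
    have sI := h.isoRoot_spec hI'
    have sJ := h.isoRoot_spec hJ'
    exact (h.2.2 _ sI.2).unique ⟨hI', sI.1⟩ ⟨hJ', e ▸ sJ.1⟩

/-! ### The threshold -/

theorem one_le_norm1 {P : ℤ[X]} (hP : P ≠ 0) : 1 ≤ norm1 P := by
  have h : P.natDegree ∈ P.support := natDegree_mem_support_of_nonzero hP
  refine le_trans (Int.natAbs_pos.mpr (mem_support_iff.mp h)) ?_
  exact Finset.single_le_sum (f := fun i => (P.coeff i).natAbs) (fun _ _ => Nat.zero_le _) h

theorem one_le_biNorm1 {F : ℤ[X][Y]} (hF : F ≠ 0) : 1 ≤ biNorm1 F := by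
  have h : F.natDegree ∈ F.support := natDegree_mem_support_of_nonzero hF
  refine le_trans (one_le_norm1 (mem_support_iff.mp h)) ?_
  exact Finset.single_le_sum (f := fun i => norm1 (F.coeff i)) (fun _ _ => Nat.zero_le _) h

/-- Two zero polynomials would have all points as solutions. -/
theorem one_le_normN {F G : ℤ[X][Y]} (h : (complexSolutions F G).Finite) : 1 ≤ normN F G := by
  by_cases hF : F = 0
  · by_cases hG : G = 0
    · refine absurd h (Set.infinite_of_injective_forall_mem (f := fun z : ℂ => (z, z))
        (fun z w e => (Prod.mk.inj e).2) fun z => ⟨?_, ?_⟩)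
      · rw [hF, map_zero]
      · rw [hG, map_zero]
    · exact (one_le_biNorm1 hG).trans (le_max_right _ _)
  · exact (one_le_biNorm1 hF).trans (le_max_left _ _)

theorem one_le_normM (F G : ℤ[X][Y]) : 1 ≤ normM F G :=
  (one_le_norm1 (noExtrRes_ne_zero F G)).trans (le_max_left _ _)

theorem eps_pos {F G : ℤ[X][Y]} (h : (complexSolutions F G).Finite) (c : ℝ) : 0 < eps F G c := by
  have h1 : (0 : ℝ) < normN F G := by exact_mod_cast one_le_normN h
  have h2 : (0 : ℝ) < normM F G := by exact_mod_cast one_le_normM F G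
  rw [eps]
  positivity

/-- A nonzero value at a pair of roots of the projections is not below the threshold. -/
theorem eps_le_abs_aevalAeval {F G : ℤ[X][Y]} (h : (complexSolutions F G).Finite) {c : ℝ}
    (hc : Admissible F G c) {H : ℤ[X][Y]} (hHN : biNorm1 H ≤ normN F G)
    (hHx : (Bivariate.swap H).natDegree ≤ degX F G) (hHy : H.natDegree ≤ degY F G) {x y : ℝ}
    (hx : aeval x (resX F G) = 0) (hy : aeval y (resY F G) = 0) (hH : aevalAeval x y H ≠ 0) :
    eps F G c ≤ |aevalAeval x y H| := by
  set t := resX F G with ht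
  set T := resY F G with hT
  have ht0 : t ≠ 0 := noExtrRes_ne_zero _ _
  have hT0 : T ≠ 0 := noExtrRes_ne_zero _ _
  have hpos : ∀ {P : ℤ[X]} {z : ℝ}, P ≠ 0 → aeval z P = 0 → 0 < P.natDegree := by
    intro P z hP hz
    refine Nat.pos_of_ne_zero fun hd => hP ?_
    rw [eq_C_of_natDegree_eq_zero hd, aeval_C] at hz
    have h1 : P.coeff 0 = 0 := by simpa using hz
    rw [eq_C_of_natDegree_eq_zero hd, h1, C_0]
  -- Both degrees are positive once there are roots, so the quotients with denominator 0 play no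
  -- role here.
  have hd₁ := hpos ht0 hx
  have hd₂ := hpos hT0 hy
  have hN : (1 : ℝ) ≤ normN F G := by exact_mod_cast one_le_normN h
  have hM : (1 : ℝ) ≤ normM F G := by exact_mod_cast one_le_normM F G
  have key := one_le_norm_aevalAeval_mul ht0 hT0 (F := H) (m := degX F G) (n := degY F G)
    (fun j => (natDegree_coeff_le_natDegree_swap H j).trans hHx) hHy hN
    (by exact_mod_cast hHN) (M := normM F G) (by exact_mod_cast le_max_left _ _)
    (by exact_mod_cast le_max_right _ _)
    ((aeval_ofReal_eq_zero_iff t x).mpr hx) ((aeval_ofReal_eq_zero_iff T y).mpr hy)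
    (by rw [aevalAeval_ofReal]; exact_mod_cast hH)
  rw [aevalAeval_ofReal, Complex.norm_real, Real.norm_eq_abs] at key
  set s := t.natDegree * T.natDegree with hs
  have hs1 : 1 ≤ s := Nat.mul_pos hd₁ hd₂
  set e := degX F G * T.natDegree + degY F G * t.natDegree with he
  have hN0 : (0 : ℝ) < normN F G := by linarith
  have hM0 : (0 : ℝ) < normM F G := by linarith
  have hNz : (normN F G : ℝ) ^ (1 - (paramS F G : ℤ)) = ((normN F G : ℝ) ^ (s - 1))⁻¹ := by
    have : (1 - (paramS F G : ℤ)) = -((s - 1 : ℕ) : ℤ) := by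
      have : paramS F G = s := rfl
      rw [this]; omega
    rw [this, zpow_neg, zpow_natCast]
  -- As `M ≥ 1`, it suffices to compare exponents; `Admissible` multiplied by `s` gives `e ≤ c s`.
  have hMz : (normM F G : ℝ) ^ (-(c * paramS F G)) ≤ ((normM F G : ℝ) ^ e)⁻¹ := by
    rw [← Real.rpow_natCast, ← Real.rpow_neg hM0.le]
    refine Real.rpow_le_rpow_of_exponent_le hM (neg_le_neg ?_)
    have hd₁' : (0 : ℝ) < t.natDegree := by exact_mod_cast hd₁
    have hd₂' : (0 : ℝ) < T.natDegree := by exact_mod_cast hd₂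
    have h1 := mul_le_mul_of_nonneg_right hc (mul_pos hd₁' hd₂').le
    have h2 : ((degX F G : ℝ) / t.natDegree + (degY F G : ℝ) / T.natDegree) *
        ((t.natDegree : ℝ) * T.natDegree) = e := by
      rw [he]; push_cast; field_simp
    have h3 : (paramS F G : ℝ) = (t.natDegree : ℝ) * T.natDegree := by
      rw [paramS, ← ht, ← hT]; push_cast; rfl
    rw [h3, ← h2]
    exact h1
  rw [eps, hNz]
  calc ((normN F G : ℝ) ^ (s - 1))⁻¹ * (normM F G : ℝ) ^ (-(c * paramS F G))
      ≤ ((normN F G : ℝ) ^ (s - 1))⁻¹ * ((normM F G : ℝ) ^ e)⁻¹ := by gcongr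
    _ ≤ |aevalAeval x y H| := by
      rw [← mul_inv, inv_le_iff_one_le_mul₀ (by positivity)]
      linarith

/-- The test of the matching accepts exactly the solutions. -/
theorem sigmaAbs_lt_eps_iff {F G : ℤ[X][Y]} (h : (complexSolutions F G).Finite) {c : ℝ}
    (hc : Admissible F G c) {x y : ℝ} (hx : aeval x (resX F G) = 0)
    (hy : aeval y (resY F G) = 0) :
    sigmaAbs F G x y < eps F G c ↔ aevalAeval x y F = 0 ∧ aevalAeval x y G = 0 := by
  have hF := eps_le_abs_aevalAeval h hc (H := F) (le_max_left _ _) (le_max_left _ _)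
    (le_max_left _ _) hx hy
  have hG := eps_le_abs_aevalAeval h hc (H := G) (le_max_right _ _) (le_max_right _ _)
    (le_max_right _ _) hx hy
  constructor
  · intro hlt
    rw [sigmaAbs] at hlt
    -- A value below `ε` must come from a vanishing polynomial. If only one of the two vanishes, the
    -- maximum exposes the other value, which is at least `ε`.
    by_cases hF0 : aevalAeval x y F = 0
    · refine ⟨hF0, ?_⟩
      by_contra hG0
      rw [if_pos (Or.inl hF0)] at hlt
      exact absurd ((hG hG0).trans (le_max_right _ _)) (not_le.mpr hlt)
    · by_cases hG0 : aevalAeval x y G = 0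
      · rw [if_pos (Or.inr hG0)] at hlt
        exact absurd ((hF hF0).trans (le_max_left _ _)) (not_le.mpr hlt)
      · rw [if_neg (not_or.mpr ⟨hF0, hG0⟩)] at hlt
        exact absurd (le_min (hF hF0) (hG hG0)) (not_le.mpr hlt)
  · rintro ⟨hF0, hG0⟩
    rw [sigmaAbs, if_pos (Or.inl hF0), hF0, hG0, abs_zero, max_self]
    exact eps_pos h c

/-! ### Correctness of the algorithm -/

theorem ZeroDimensional.finite_complexSolutions {f g : ℚ[X][Y]} (h : ZeroDimensional f g) :
    (complexSolutions (clearDen f) (clearDen g)).Finite := by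
  refine h.subset fun p hp => ?_
  exact ⟨(aevalAeval_clearDen_eq_zero_iff f _ _).mp hp.1,
    (aevalAeval_clearDen_eq_zero_iff g _ _).mp hp.2⟩

theorem mem_realSolutions_iff {f g : ℚ[X][Y]} {p : ℝ × ℝ} :
    p ∈ realSolutions f g ↔
      aevalAeval p.1 p.2 (clearDen f) = 0 ∧ aevalAeval p.1 p.2 (clearDen g) = 0 := by
  rw [aevalAeval_clearDen_eq_zero_iff, aevalAeval_clearDen_eq_zero_iff]
  rfl

theorem aeval_resX_eq_zero {F G : ℤ[X][Y]} (h : (complexSolutions F G).Finite) {x y : ℝ}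
    (hF : aevalAeval x y F = 0) (hG : aevalAeval x y G = 0) : aeval x (resX F G) = 0 := by
  rw [← aeval_ofReal_eq_zero_iff]
  exact aeval_noExtrRes_eq_zero h (y := (y : ℂ)) (by rw [aevalAeval_ofReal, hF, Complex.ofReal_zero])
    (by rw [aevalAeval_ofReal, hG, Complex.ofReal_zero])

theorem aeval_resY_eq_zero {F G : ℤ[X][Y]} (h : (complexSolutions F G).Finite) {x y : ℝ}
    (hF : aevalAeval x y F = 0) (hG : aevalAeval x y G = 0) : aeval y (resY F G) = 0 := by
  refine aeval_resX_eq_zero (F := Bivariate.swap F) (G := Bivariate.swap G) (y := x) ?_ ?_ ?_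
  · rw [complexSolutions_swap]; exact h.image _
  · rw [Bivariate.aevalAeval_swap, hF]
  · rw [Bivariate.aevalAeval_swap, hG]

/-- The matched pairs of a run are the pairs of isolating intervals that pass the test. -/
theorem RunInt.mem_boxes_iff {F G : ℤ[X][Y]} {c : ℝ} {r : Result} (hr : RunInt F G c r)
    {B : (ℚ × ℚ) × (ℚ × ℚ)} :
    B ∈ r.boxes ↔ B.1 ∈ r.intervalsX ∧ B.2 ∈ r.intervalsY ∧
      sigmaAbs F G (isoRoot (resX F G) B.1) (isoRoot (resY F G) B.2) < eps F G c := by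
  have := (Prod.mk.inj (hr.2.2.trans (matchAll_eq _ _ _))).1
  obtain ⟨I, J⟩ := B
  rw [this, List.mem_filter, List.mem_product]
  simp [pairTest, and_assoc]

/-- Coordinates of real solutions are roots of the projections, so uniqueness in a box, and of the
box, is inherited from the two axes. -/
theorem RunInt.correct {f g : ℚ[X][Y]} (h : ZeroDimensional f g) {c : ℝ}
    (hc : Admissible (clearDen f) (clearDen g) c) {r : Result}
    (hr : RunInt (clearDen f) (clearDen g) c r)
    (hX : IsIsolation (resX (clearDen f) (clearDen g)) r.intervalsX)
    (hY : IsIsolation (resY (clearDen f) (clearDen g)) r.intervalsY) :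
    solutionSet (clearDen f) (clearDen g) r = realSolutions f g ∧
      IsolatesSolutions f g r.boxes := by
  set F := clearDen f with hF
  set G := clearDen g with hG
  have hfin : (complexSolutions F G).Finite := h.finite_complexSolutions
  have hbox : ∀ B ∈ r.boxes, B.1 ∈ r.intervalsX ∧ B.2 ∈ r.intervalsY ∧
      (isoRoot (resX F G) B.1, isoRoot (resY F G) B.2) ∈ realSolutions f g := by
    intro B hB
    obtain ⟨h1, h2, h3⟩ := hr.mem_boxes_iff.mp hB
    exact ⟨h1, h2, mem_realSolutions_iff.mpr ((sigmaAbs_lt_eps_iff hfin hc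
      (hX.isoRoot_spec h1).2 (hY.isoRoot_spec h2).2).mp h3)⟩
  have hsol : ∀ p ∈ realSolutions f g, ∃ B ∈ r.boxes, (InIv B.1 p.1 ∧ InIv B.2 p.2) ∧
      p = (isoRoot (resX F G) B.1, isoRoot (resY F G) B.2) := by
    intro p hp
    have hp' := mem_realSolutions_iff.mp hp
    have hx := aeval_resX_eq_zero hfin hp'.1 hp'.2
    have hy := aeval_resY_eq_zero hfin hp'.1 hp'.2
    obtain ⟨I, ⟨hI, hI'⟩, -⟩ := hX.2.2 _ hx
    obtain ⟨J, ⟨hJ, hJ'⟩, -⟩ := hY.2.2 _ hy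
    have e1 := hX.eq_isoRoot hI hI' hx
    have e2 := hY.eq_isoRoot hJ hJ' hy
    refine ⟨(I, J), hr.mem_boxes_iff.mpr ⟨hI, hJ, ?_⟩, ⟨hI', hJ'⟩, Prod.ext e1 e2⟩
    rw [← e1, ← e2]
    exact (sigmaAbs_lt_eps_iff hfin hc hx hy).mpr hp'
  refine ⟨?_, ?_, ?_, ?_⟩
  · ext p
    constructor
    · rintro ⟨B, hB, rfl⟩
      exact (hbox B hB).2.2
    · intro hp
      obtain ⟨B, hB, -, e⟩ := hsol p hp
      exact ⟨B, hB, e⟩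
  · have := (Prod.mk.inj (hr.2.2.trans (matchAll_eq _ _ _))).1
    rw [this]
    exact (hX.1.product hY.1).filter _
  · intro B hB
    obtain ⟨h1, h2, h3⟩ := hbox B hB
    refine ⟨_, ⟨⟨(hX.isoRoot_spec h1).1, (hY.isoRoot_spec h2).1⟩, h3⟩, ?_⟩
    rintro p ⟨⟨hp1, hp2⟩, hp⟩
    have hp' := mem_realSolutions_iff.mp hp
    exact Prod.ext (hX.eq_isoRoot h1 hp1 (aeval_resX_eq_zero hfin hp'.1 hp'.2))
      (hY.eq_isoRoot h2 hp2 (aeval_resY_eq_zero hfin hp'.1 hp'.2))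
  · intro p hp
    obtain ⟨B, hB, hpB, -⟩ := hsol p hp
    have hp' := mem_realSolutions_iff.mp hp
    refine ⟨B, ⟨hB, hpB⟩, ?_⟩
    rintro B' ⟨hB', hpB'⟩
    refine Prod.ext ?_ ?_
    · exact (hX.2.2 _ (aeval_resX_eq_zero hfin hp'.1 hp'.2)).unique
        ⟨(hbox B' hB').1, hpB'.1⟩ ⟨(hbox B hB).1, hpB.1⟩
    · exact (hY.2.2 _ (aeval_resY_eq_zero hfin hp'.1 hp'.2)).unique
        ⟨(hbox B' hB').2.1, hpB'.2⟩ ⟨(hbox B hB).2.1, hpB.2⟩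

end ZMM

theorem theorem3p1 :
    ∃ K : ℝ, 0 < K ∧
      ∀ f g : Polynomial (Polynomial ℚ), ZMM.ZeroDimensional f g →
      ∀ F G : Polynomial (Polynomial ℤ), F = ZMM.clearDen f → G = ZMM.clearDen g →
      ∀ t T : Polynomial ℤ, t = ZMM.resX F G → T = ZMM.resY F G →
      ∀ c : ℝ, ZMM.Admissible F G c →
        -- the algorithm terminates
        (∃ r : ZMM.Result, ZMM.Run f g c r) ∧
        ∀ r : ZMM.Result, ZMM.Run f g c r →
          -- correctness
          (ZMM.IsIsolation t r.intervalsX ∧ ZMM.IsIsolation T r.intervalsY ∧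
            ZMM.solutionSet F G r = ZMM.realSolutions f g ∧
            ZMM.IsolatesSolutions f g r.boxes) ∧
          -- real solving of the two univariate polynomials
          ((r.stepsX : ℝ) ≤ K * ZMM.solveBound t ∧ (r.stepsY : ℝ) ≤ K * ZMM.solveBound T) ∧
          -- matching, with `u` and `v` the numbers of real roots of `t` and `T`
          (r.matchSteps : ℝ) ≤
            K * ((t.rootSet ℝ).ncard * (T.rootSet ℝ).ncard) := by
  -- The constant is dictated by the isolation; the matching needs only a constant at least 1.
  refine ⟨33, by norm_num, ?_⟩
  rintro f g hfg F G rfl rfl t T rfl rfl c hc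
  have hsX := ZMM.separable_noExtrRes (ZMM.clearDen f) (ZMM.clearDen g)
  have hsY := ZMM.separable_noExtrRes (Bivariate.swap (ZMM.clearDen f))
    (Bivariate.swap (ZMM.clearDen g))
  have htX := ZMM.noExtrRes_ne_zero (ZMM.clearDen f) (ZMM.clearDen g)
  have htY := ZMM.noExtrRes_ne_zero (Bivariate.swap (ZMM.clearDen f))
    (Bivariate.swap (ZMM.clearDen g))
  constructor
  · obtain ⟨L₁, n₁, h₁⟩ := ZMM.exists_isolate hsX
    obtain ⟨L₂, n₂, h₂⟩ := ZMM.exists_isolate hsY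
    exact ⟨⟨L₁, n₁, L₂, n₂, _, _⟩, h₁, h₂, (ZMM.matchAll_eq _ _ _).symm⟩
  · intro r hr
    have hX := hr.1.isIsolation htX
    have hY := hr.2.1.isIsolation htY
    refine ⟨⟨hX, hY, ZMM.RunInt.correct hfg hc hr hX hY⟩, ⟨hr.1.steps_le hsX, hr.2.1.steps_le hsY⟩,
      ?_⟩
    have hsteps : r.matchSteps = r.intervalsX.length * r.intervalsY.length :=
      (Prod.mk.inj (hr.2.2.trans (ZMM.matchAll_eq _ _ _))).2
    have hle := Nat.mul_le_mul (hX.length_le htX) (hY.length_le htY)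
    rw [← hsteps] at hle
    have hle' : (r.matchSteps : ℝ) ≤
        ((ZMM.resX (ZMM.clearDen f) (ZMM.clearDen g)).rootSet ℝ).ncard *
          ((ZMM.resY (ZMM.clearDen f) (ZMM.clearDen g)).rootSet ℝ).ncard := by
      exact_mod_cast hle
    refine hle'.trans (le_mul_of_one_le_left (by positivity) (by norm_num))
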